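/- **Setting.** Let $(M,\tau)$ be a tracial von Neumann algebra (a von Neumann algebra with a faithful normal tracial state). For a tuple $\mathbf R=(R_i)_{i\in I}\in(0,\infty)^I$, let $\Sigma_{\mathbf R}$ be the set of linear functionals $\lambda$ on the free algebra $\mathbb C\langle t_i:i\in I\rangle$ (with the $*$-structure making each $t_i$ self-adjoint) which satisfy $\lambda(1)=1$, $\lambda(p^*p)\ge 0$, $\lambda(pq)=\lambda(qp)$ and $|\lambda(t_{i_1}\cdots t_{i_\ell})|\le R_{i_1}\cdots R_{i_\ell}$, with the topology of pointwise convergence. The law of a self-adjoint tuple $\mathbf x$ in $M$ is $\lambda_{\mathbf x}(p)=\tau(p(\mathbf x))$; for self-adjoint $n\times n$ matrices one uses the normalized trace $\frac1n\mathrm{Tr}$, with $\|A\|_2=(\frac1n\mathrm{Tr}(A^*A))^{1/2}$. For $\mathcal O\subseteq\Sigma_{\mathbf R}$ let $$\Gamma^{(n)}_{\mathbf R}(\mathcal O)=\{\mathbf Y\in M_n(\mathbb C)_{sa}^I:\ \|Y_i\|\le R_i\ \text{for all } i\in I,\ \lambda_{\mathbf Y}\in\mathcal O\}.$$ For $F\subseteq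 I$ finite, $\varepsilon>0$ and $\Omega\subseteq M_n(\mathbb C)_{sa}^I$, let $K^{\mathrm{orb}}_{F,\varepsilon}(\Omega)$ be the minimal cardinality of a set $\Omega'\subseteq M_n(\mathbb C)_{sa}^I$ such that for each $\mathbf Y\in\Omega$ there are $\mathbf Y'\in\Omega'$ and a unitary $U$ with $\|Y_i-UY'_iU^*\|_2<\varepsilon$ for all $i\in F$. For self-adjoint tuples $\mathbf x\in M_{sa}^I$, $\mathbf y\in M_{sa}^J$ and $\mathbf R\in(0,\infty)^I$, $\mathbf S\in(0,\infty)^J$ with $\|x_i\|\le R_i$, $\|y_j\|\le S_j$, put $$h_{\mathbf R,\mathbf S}(\mathbf x:\mathbf y)=\sup_{F\subseteq I\text{ finite},\ \varepsilon>0}\ \inf_{\mathcal O\ni\lambda_{(\mathbf x,\mathbf y)}}\ \limsup_{n\to\infty}\frac1{n^2}\log K^{\mathrm{orb}}_{F,\varepsilon}\bigl(\pi_I(\Gamma^{(n)}_{(\mathbf R,\mathbf S)}(\mathcal O))\bigr)\in[-\infty,\infty],$$ where $\mathcal O$ runs over the neighborhoods of $\lambda_{(\mathbf x,\mathbf y)}$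 in $\Sigma_{(\mathbf R,\mathbf S)}$, $\pi_I$ is the projection to the $I$-indexed coordinates, and $\log 0=-\infty$. Write $\mathrm W^*(\mathbf x)\subseteq M$ for the von Neumann subalgebra generated by $\mathbf x$. For von Neumann subalgebras $N\le P\le M$, let $h(N:P)$ be $h_{\mathbf R,\mathbf S}(\mathbf x:\mathbf y)$ (computed in $(P,\tau|_P)$) for one choice of self-adjoint tuples with $\mathrm W^*(\mathbf x)=N$ and $\mathrm W^*(\mathbf x,\mathbf y)=P$ and of cutoffs: $\mathbf x$ all self-adjoint elements of $N$, $\mathbf y$ all self-adjoint elements of $P$, with cutoffs $\|x_i\|+1$ and $\|y_j\|+1$. **Theorem.** Let $I,J,I',J'$ be arbitrary index sets, let $\mathbf x\in M_{sa}^I$, $\mathbf y\in M_{sa}^J$ with cutoffs $\mathbf R\in(0,\infty)^I$, $\mathbf S\in(0,\infty)^J$ satisfying $\|x_i\|\le R_i$, $\|y_j\|\le S_j$, and let $\mathbf x'\in M_{sa}^{I'}$, $\mathbf y'\in M_{sa}^{J'}$, $\mathbf R'$, $\mathbf S'$ satisfy the corresponding conditions. 1. If $\mathrm W^*(\mathbf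 x,\mathbf y)\supseteq\mathrm W^*(\mathbf x',\mathbf y')$ and $\mathrm W^*(\mathbf x)\subseteq\mathrm W^*(\mathbf x')$, then $h_{\mathbf R,\mathbf S}(\mathbf x:\mathbf y)\le h_{\mathbf R',\mathbf S'}(\mathbf x':\mathbf y')$. 2. $h_{\mathbf R,\mathbf S}(\mathbf x:\mathbf y)$ does not depend on the choice of cutoffs $\mathbf R,\mathbf S$ with $\|x_i\|\le R_i$ and $\|y_j\|\le S_j$. 3. If $\mathrm W^*(\mathbf x,\mathbf y)=\mathrm W^*(\mathbf x',\mathbf y')$ and $\mathrm W^*(\mathbf x)=\mathrm W^*(\mathbf x')$, then $h_{\mathbf R,\mathbf S}(\mathbf x:\mathbf y)=h_{\mathbf R',\mathbf S'}(\mathbf x':\mathbf y')$. 4. If $N\le P\le M$ are von Neumann subalgebras with $\mathrm W^*(\mathbf x)=N$ and $\mathrm W^*(\mathbf x,\mathbf y)=P$, then $h(N:P)=h_{\mathbf R,\mathbf S}(\mathbf x:\mathbf y)$; that is, $h(N:P)$ is well defined. 5. If $P\le N\le M$, then $h(P:M)\le h(N:M)$. 6. If $P\le N\le M$, then $h(P:M)\le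 h(P:N)$. -/

import Mathlib

open Filter Topology
open scoped ComplexOrder InnerProductSpace

noncomputable section

/-! ### Tracial von Neumann algebras and generated subalgebras -/

/-- A faithful normal tracial state on a von Neumann algebra `M` acting on a Hilbert space `H`.
Normality is ultraweak continuity: `τ` is a square-summable series of vector functionals. -/
structure TracialState {H : Type*} [NormedAddCommGroup H] [InnerProductSpace ℂ H]
    [CompleteSpace H] (M : VonNeumannAlgebra H) where
  /-- the underlying linear functional -/
  toLin : M.toStarSubalgebra →ₗ[ℂ] ℂ
  map_one : toLin 1 = 1
  nonneg : ∀ a : M.toStarSubalgebra, 0 ≤ (a : H →L[ℂ] H) → 0 ≤ toLin a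
  tracial : ∀ a b : M.toStarSubalgebra, toLin (a * b) = toLin (b * a)
  faithful : ∀ a : M.toStarSubalgebra, toLin (star a * a) = 0 → a = 0
  normal : ∃ ξ η : ℕ → H, Summable (fun k => ‖ξ k‖ ^ 2) ∧ Summable (fun k => ‖η k‖ ^ 2) ∧
    ∀ a : M.toStarSubalgebra, HasSum (fun k => ⟪η k, (a : H →L[ℂ] H) (ξ k)⟫_ℂ) (toLin a)

/-- The inclusion `N ⊆ M` of von Neumann algebras on `H`, as a linear map. -/
def vnIncl {H : Type*} [NormedAddCommGroup H] [InnerProductSpace ℂ H] [CompleteSpace H]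
    {N M : VonNeumannAlgebra H} (h : N ≤ M) : N.toStarSubalgebra →ₗ[ℂ] M.toStarSubalgebra where
  toFun a := ⟨a.1, h a.2⟩
  map_add' _ _ := rfl
  map_smul' _ _ := rfl

/-- The restriction of the trace to a von Neumann subalgebra. -/
def TracialState.restrict {H : Type*} [NormedAddCommGroup H] [InnerProductSpace ℂ H]
    [CompleteSpace H] {M N : VonNeumannAlgebra H} (τ : TracialState M) (h : N ≤ M) :
    TracialState N where
  toLin := τ.toLin ∘ₗ vnIncl h
  map_one := τ.map_one
  nonneg a ha := τ.nonneg (vnIncl h a) ha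
  tracial a b := τ.tracial (vnIncl h a) (vnIncl h b)
  faithful a ha := by
    have h0 : vnIncl h a = 0 := τ.faithful (vnIncl h a) ha
    have h1 : ((vnIncl h a : M.toStarSubalgebra) : H →L[ℂ] H) = 0 := by rw [h0]; rfl
    exact Subtype.ext h1
  normal := by
    obtain ⟨ξ, η, h1, h2, h3⟩ := τ.normal
    exact ⟨ξ, η, h1, h2, fun a => h3 (vnIncl h a)⟩

/-- The von Neumann algebra generated by a set `X` of operators:
the double commutant of `X ∪ X*`. -/
def wStar {H : Type*} [NormedAddCommGroup H] [InnerProductSpace ℂ H] [CompleteSpace H]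
    (X : Set (H →L[ℂ] H)) : VonNeumannAlgebra H where
  toStarSubalgebra :=
    StarSubalgebra.centralizer ℂ (StarSubalgebra.centralizer ℂ X : Set (H →L[ℂ] H))
  centralizer_centralizer' := by
    have h := StarSubalgebra.coe_centralizer_centralizer (R := ℂ) X
    change Set.centralizer (Set.centralizer
      (StarSubalgebra.centralizer ℂ (StarSubalgebra.centralizer ℂ X : Set (H →L[ℂ] H)) :
        Set (H →L[ℂ] H))) = (StarSubalgebra.centralizer ℂ
          (StarSubalgebra.centralizer ℂ X : Set (H →L[ℂ] H)) : Set (H →L[ℂ] H))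
    rw [h, Set.centralizer_centralizer_centralizer]

/-- `wStar X` is the smallest von Neumann algebra containing `X`. -/
theorem wStar_le_iff {H : Type*} [NormedAddCommGroup H] [InnerProductSpace ℂ H]
    [CompleteSpace H] (X : Set (H →L[ℂ] H)) (N : VonNeumannAlgebra H) :
    wStar X ≤ N ↔ X ⊆ (N : Set (H →L[ℂ] H)) := by
  have hc : ((wStar X : VonNeumannAlgebra H) : Set (H →L[ℂ] H))
      = (X ∪ star X).centralizer.centralizer :=
    StarSubalgebra.coe_centralizer_centralizer (R := ℂ) X
  rw [← SetLike.coe_subset_coe, hc]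
  constructor
  · intro h a ha
    exact h (Set.subset_centralizer_centralizer (Or.inl ha))
  · intro h
    have hs : X ∪ star X ⊆ (N : Set (H →L[ℂ] H)) := by
      rintro a (ha | ha)
      · exact h ha
      · have := star_mem (S := VonNeumannAlgebra H) (s := N) (h ha)
        simpa using this
    rw [← N.centralizer_centralizer]
    exact Set.centralizer_subset (Set.centralizer_subset hs)

/-- `W*(x)`, the von Neumann algebra generated by a tuple `x` of elements of `M`. -/
def wStarTuple {H : Type*} [NormedAddCommGroup H] [InnerProductSpace ℂ H] [CompleteSpace H]
    {M : VonNeumannAlgebra H} {I : Type*} (x : I → M.toStarSubalgebra) : VonNeumannAlgebra H :=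
  wStar (Set.range fun i => (x i : H →L[ℂ] H))

/-- `x` is a self-adjoint tuple, `R` is a tuple of positive reals, and `‖x i‖ ≤ R i`. -/
def IsCutoff {H : Type*} [NormedAddCommGroup H] [InnerProductSpace ℂ H] [CompleteSpace H]
    {M : VonNeumannAlgebra H} {I : Type*} (R : I → ℝ) (x : I → M.toStarSubalgebra) : Prop :=
  ∀ i, 0 < R i ∧ IsSelfAdjoint (x i) ∧ ‖(x i : H →L[ℂ] H)‖ ≤ R i

/-! ### Non-commutative laws -/

/-- The conjugate-linear involution of `ℂ⟨t_i : i ∈ I⟩` for which each `t_i` is self-adjoint: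
conjugate the coefficients, then reverse the words (`star` on Mathlib's `FreeAlgebra` is the linear
reversal of words). -/
def ncStar {I : Type*} (p : FreeAlgebra ℂ I) : FreeAlgebra ℂ I :=
  star (FreeAlgebra.equivMonoidAlgebraFreeMonoid.symm
    (MonoidAlgebra.mapRingHom (FreeMonoid I) (starRingEnd ℂ)
      (FreeAlgebra.equivMonoidAlgebraFreeMonoid p)))

theorem ncStar_ι {I : Type*} (i : I) : ncStar (FreeAlgebra.ι ℂ i) = FreeAlgebra.ι ℂ i := by
  simp [ncStar, FreeAlgebra.equivMonoidAlgebraFreeMonoid]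

theorem ncStar_add {I : Type*} (p q : FreeAlgebra ℂ I) : ncStar (p + q) = ncStar p + ncStar q := by
  simp [ncStar]

theorem ncStar_mul {I : Type*} (p q : FreeAlgebra ℂ I) : ncStar (p * q) = ncStar q * ncStar p := by
  simp [ncStar]

theorem ncStar_algebraMap {I : Type*} (c : ℂ) :
    ncStar (algebraMap ℂ (FreeAlgebra ℂ I) c) = algebraMap ℂ _ (starRingEnd ℂ c) := by
  simp only [ncStar, AlgEquiv.commutes]
  have : (MonoidAlgebra.mapRingHom (FreeMonoid I) (starRingEnd ℂ))
      ((algebraMap ℂ (MonoidAlgebra ℂ (FreeMonoid I))) c) = algebraMap ℂ _ (starRingEnd ℂ c) := by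
    simp
  rw [this, AlgEquiv.commutes, FreeAlgebra.star_algebraMap]

/-- The space `Σ_R` of tracial non-commutative laws with exponential bounds `R`, inside the space
of all functions on `ℂ⟨t_i : i ∈ I⟩` with the topology of pointwise convergence. -/
def lawSpace {I : Type*} (R : I → ℝ) : Set (FreeAlgebra ℂ I → ℂ) :=
  {l | IsLinearMap ℂ l ∧ l 1 = 1 ∧ (∀ p, 0 ≤ l (ncStar p * p)) ∧ (∀ p q, l (p * q) = l (q * p)) ∧
    ∀ w : List I, ‖l (w.map (FreeAlgebra.ι ℂ)).prod‖ ≤ (w.map R).prod}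

/-- The non-commutative law `λ_x : p ↦ τ(p(x))` of a tuple in a tracial von Neumann algebra. -/
def TracialState.law {H : Type*} [NormedAddCommGroup H] [InnerProductSpace ℂ H]
    [CompleteSpace H] {M : VonNeumannAlgebra H} (τ : TracialState M) {I : Type*}
    (x : I → M.toStarSubalgebra) : FreeAlgebra ℂ I → ℂ :=
  fun p => τ.toLin (FreeAlgebra.lift ℂ x p)

/-- The non-commutative law `λ_Y : p ↦ (1/n) Tr(p(Y))` of a tuple of `n × n` matrices. -/
def matrixLaw {I : Type*} {n : ℕ} (Y : I → Matrix (Fin n) (Fin n) ℂ) : FreeAlgebra ℂ I → ℂ :=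
  fun p => (n : ℂ)⁻¹ * Matrix.trace (FreeAlgebra.lift ℂ Y p)

/-! ### Microstate spaces and orbital covering numbers -/

/-- The operator norm of a matrix acting on `ℂⁿ` with its Euclidean norm. -/
def matrixOpNorm {n : ℕ} (A : Matrix (Fin n) (Fin n) ℂ) : ℝ :=
  ‖Matrix.toEuclideanCLM (n := Fin n) (𝕜 := ℂ) A‖

/-- The normalized Hilbert-Schmidt norm `‖A‖₂ = ((1/n) Tr(A* A))^{1/2}`. -/
def matrixNorm2 {n : ℕ} (A : Matrix (Fin n) (Fin n) ℂ) : ℝ :=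
  Real.sqrt ((n : ℝ)⁻¹ * (Matrix.trace (A.conjTranspose * A)).re)

/-- Tuples of self-adjoint `n × n` matrices. -/
def saMatrixTuples (I : Type*) (n : ℕ) : Set (I → Matrix (Fin n) (Fin n) ℂ) :=
  {Y | ∀ i, (Y i).IsHermitian}

/-- The microstate space `Γ_R^{(n)}(O)`. -/
def microstates {I : Type*} (R : I → ℝ) (O : Set (FreeAlgebra ℂ I → ℂ)) (n : ℕ) :
    Set (I → Matrix (Fin n) (Fin n) ℂ) :=
  {Y | Y ∈ saMatrixTuples I n ∧ (∀ i, matrixOpNorm (Y i) ≤ R i) ∧ matrixLaw Y ∈ O}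

/-- The orbital `(F, ε)`-neighborhood of a set of self-adjoint matrix tuples. -/
def orbNhd {I : Type*} {n : ℕ} (F : Finset I) (ε : ℝ)
    (Ω : Set (I → Matrix (Fin n) (Fin n) ℂ)) : Set (I → Matrix (Fin n) (Fin n) ℂ) :=
  {Y | Y ∈ saMatrixTuples I n ∧ ∃ Y' ∈ Ω, ∃ U ∈ Matrix.unitaryGroup (Fin n) ℂ,
    ∀ i ∈ F, matrixNorm2 (Y i - U * Y' i * U.conjTranspose) < ε}

/-- The orbital covering number `K_{F,ε}^{orb}(Ω)`: the minimal cardinality of a set `Ω'` of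
self-adjoint matrix tuples whose orbital `(F, ε)`-neighborhood contains `Ω`. -/
def orbCoveringNumber {I : Type*} {n : ℕ} (F : Finset I) (ε : ℝ)
    (Ω : Set (I → Matrix (Fin n) (Fin n) ℂ)) : ℕ∞ :=
  ⨅ Ω' ∈ {Ω' : Set (I → Matrix (Fin n) (Fin n) ℂ) |
    Ω' ⊆ saMatrixTuples I n ∧ Ω ⊆ orbNhd F ε Ω'}, Set.encard Ω'

/-! ### The 1-bounded entropy in the presence -/

/-- The quantity `h_{R,S}(x : y)`, with values in `[-∞, ∞]` (and `log 0 = -∞`). The infimum is over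
all neighborhoods `O` of `λ_{(x,y)}` in the subspace `Σ_{(R,S)}`, and the image under
`Y ↦ Y ∘ Sum.inl` is the projection to the `I`-indexed coordinates. -/
def entropyTuple {H : Type*} [NormedAddCommGroup H] [InnerProductSpace ℂ H] [CompleteSpace H]
    {M : VonNeumannAlgebra H} (τ : TracialState M) {I J : Type*} (R : I → ℝ) (S : J → ℝ)
    (x : I → M.toStarSubalgebra) (y : J → M.toStarSubalgebra) : EReal :=
  ⨆ (F : Finset I) (ε : ℝ) (_ : 0 < ε),
    ⨅ O ∈ 𝓝[lawSpace (Sum.elim R S)] (τ.law (Sum.elim x y)),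
      limsup (fun n : ℕ => (((n : ℝ) ^ 2)⁻¹ : ℝ) *
        ENNReal.log (orbCoveringNumber F ε
          ((fun Y i => Y (Sum.inl i)) '' microstates (Sum.elim R S) O n) : ENNReal)) atTop

/-- All self-adjoint elements of `N` (as elements of `M ⊇ N`), a generating tuple of `N`. -/
def allSelfAdjoint {H : Type*} [NormedAddCommGroup H] [InnerProductSpace ℂ H] [CompleteSpace H]
    (N M : VonNeumannAlgebra H) :
    {a : M.toStarSubalgebra // IsSelfAdjoint a ∧ (a : H →L[ℂ] H) ∈ N} → M.toStarSubalgebra :=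
  Subtype.val

/-- The canonical generators generate. -/
theorem wStarTuple_allSelfAdjoint {H : Type*} [NormedAddCommGroup H]
    [InnerProductSpace ℂ H] [CompleteSpace H] (M N : VonNeumannAlgebra H) (h : N ≤ M) :
    wStarTuple (allSelfAdjoint N M) = N := by
  apply le_antisymm
  · rw [wStarTuple, wStar_le_iff]
    rintro _ ⟨a, rfl⟩; exact a.2.2
  · intro a ha
    have key : ∀ b ∈ N, IsSelfAdjoint b → b ∈ wStarTuple (allSelfAdjoint N M) := by
      intro b hb hs
      exact (wStar_le_iff _ _).1 le_rfl ⟨⟨⟨b, h hb⟩, Subtype.ext hs, hb⟩, rfl⟩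
    have hd : a = (2:ℂ)⁻¹ • (a + star a) + (-Complex.I * 2⁻¹) • (Complex.I • (a - star a)) := by
      rw [smul_smul, show -Complex.I * 2⁻¹ * Complex.I = (2:ℂ)⁻¹ by
        linear_combination (-(2:ℂ)⁻¹) * Complex.I_mul_I, ← smul_add,
        add_add_sub_cancel, ← two_smul ℂ a, smul_smul]
      norm_num
    have h1 := key _ (add_mem ha (star_mem ha)) (IsSelfAdjoint.add_star_self a)
    have h2 := key (Complex.I • (a - star a))
      (N.toStarSubalgebra.smul_mem (sub_mem ha (star_mem ha)) _) (by
      rw [isSelfAdjoint_iff, star_smul]; simp [sub_eq_add_neg, add_comm])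
    rw [hd]
    exact add_mem (StarSubalgebra.smul_mem (wStarTuple (allSelfAdjoint N M)).toStarSubalgebra h1 _)
      (StarSubalgebra.smul_mem (wStarTuple (allSelfAdjoint N M)).toStarSubalgebra h2 _)

/-- The 1-bounded entropy `h(N : M)` of `N` in the presence of `M`, for `N ≤ M`: the value
`h_{R,S}(x : y)` for one choice of tuples with `W*(x) = N` and `W*(x, y) = M`, namely `x` all the
self-adjoint elements of `N` and `y` all the self-adjoint elements of `M`. -/
def entropyInPresence {H : Type*} [NormedAddCommGroup H] [InnerProductSpace ℂ H]
    [CompleteSpace H] {M : VonNeumannAlgebra H} (τ : TracialState M) (N : VonNeumannAlgebra H) :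
    EReal :=
  entropyTuple τ (fun a => ‖(allSelfAdjoint N M a : H →L[ℂ] H)‖ + 1)
    (fun a => ‖(allSelfAdjoint M M a : H →L[ℂ] H)‖ + 1) (allSelfAdjoint N M) (allSelfAdjoint M M)

end

/-! ### Tracial functionals on C*-algebras and the associated 2-norm -/

/-! Everything reduces to the inequality `entropyTuple_le`. Since `W*(x', y') ⊆ W*(x, y)`, the tuple
`(x', y')` is a limit in 2-norm of polynomials `f m` in `(x, y)`; since `W*(x) ⊆ W*(x')`, each `x i`
is close in 2-norm to a polynomial `q i` in `x'`. For a good enough `m`, `f m` sends microstates of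
`(x, y)` to microstates of `(x', y')`, and `q` almost recovers the `x`-part from the `x'`-part of
the image. Polynomials commute with unitary conjugation and are 2-norm Lipschitz on operator-norm
balls, with constants independent of the matrix size. An orbital cover of the `x'`-parts therefore
pulls back to one of the `x`-parts with no more centres, and this passes to the limsup, infimum and
supremum (`orbCoveringNumber_le`, `orbCoveringNumber_microstates_le`).

The delicate point is that `f m` must respect the prescribed cutoffs on every bounded self-adjoint
matrix tuple, not just at `(x, y)`. `TracialState.exists_bounded_approx` secures this as in
Kaplansky's theorem: with `G t = 2t / (1 + t²)`, a self-adjoint `a` of norm at most `s` is `s • G b`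
for some self-adjoint `b` in the generated algebra. One approximates `b` by a polynomial `p` with no
norm control and applies to `p` a real polynomial close to `G` and bounded by 1. This works because
`G` is Lipschitz in 2-norm on all self-adjoint elements (`norm2_cfc_sub_le`). The unbounded density
itself is the double commutant argument on `ℓ²(ι; H)`, where normality makes one vector dominate the
2-norm.

Independence of cutoffs and of generators are two opposite instances of the inequality; the
statements on `h(N : P)` follow because the entropy depends on the trace only through the law of the
tuple. -/

/-- `τ` is a tracial state. -/
structure IsTracialState {A : Type*} [CStarAlgebra A] (τ : A →ₗ[ℂ] ℂ) : Prop where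
  map_one : τ 1 = 1
  nonneg : ∀ a, 0 ≤ τ (star a * a)
  tracial : ∀ a b, τ (a * b) = τ (b * a)

/-- The 2-norm `‖a‖₂ = τ(a* a)^{1/2}`. -/
noncomputable def norm2 {A : Type*} [CStarAlgebra A] (τ : A →ₗ[ℂ] ℂ) (a : A) : ℝ :=
  Real.sqrt (τ (star a * a)).re

namespace IsTracialState

variable {A : Type*} [CStarAlgebra A] {τ : A →ₗ[ℂ] ℂ} (hτ : IsTracialState τ)
include hτ

theorem map_of_isSelfAdjoint {a : A} (ha : IsSelfAdjoint a) :
    (starRingEnd ℂ) (τ a) = τ a := by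
  have key : ∀ b, (starRingEnd ℂ) (τ (star b * b)) = τ (star b * b) := fun b =>
    Complex.conj_eq_iff_im.2 (Complex.nonneg_iff.1 (hτ.nonneg b)).2.symm
  -- Polarization against 1 writes `a` as a difference of squares, on which `τ` is real by
  -- positivity.
  have e : a = (4 : ℂ)⁻¹ • (star (a + 1) * (a + 1)) - (4 : ℂ)⁻¹ • (star (a - 1) * (a - 1)) := by
    rw [← smul_sub, star_add, star_sub, ha.star_eq, star_one]
    have : (a + 1) * (a + 1) - (a - 1) * (a - 1) = (4 : ℂ) • a := by
      rw [ofNat_smul_eq_nsmul]; noncomm_ring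
    rw [this, smul_smul]; norm_num
  rw [e]
  have h4 : (starRingEnd ℂ) (4 : ℂ)⁻¹ = (4 : ℂ)⁻¹ := by
    rw [map_inv₀]; exact congrArg _ (Complex.conj_ofReal 4)
  simp only [map_sub, map_smul, smul_eq_mul, map_mul, key, h4]

theorem map_star (a : A) : τ (star a) = (starRingEnd ℂ) (τ a) := by
  have h1 := hτ.map_of_isSelfAdjoint (IsSelfAdjoint.add_star_self a)
  have h2 := hτ.map_of_isSelfAdjoint (a := Complex.I • (a - star a)) (by
    rw [isSelfAdjoint_iff, star_smul]; simp [sub_eq_add_neg, add_comm])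
  simp only [map_add, map_smul, map_sub, smul_eq_mul, map_mul, Complex.conj_I] at h1 h2
  have h3 : (starRingEnd ℂ) (τ a) - (starRingEnd ℂ) (τ (star a)) = -(τ a - τ (star a)) := by
    have := congrArg (fun z => Complex.I * z) h2
    simp only [← mul_assoc, mul_neg, neg_mul, Complex.I_mul_I] at this
    simpa using this
  linear_combination (1/2 : ℂ) * (-h1) - (1/2 : ℂ) * h3

/-- The (semi-definite) inner product `τ(a* b)`. -/
noncomputable abbrev core : PreInnerProductSpace.Core ℂ A where
  inner a b := τ (star a * b)
  conj_inner_symm a b := by rw [← hτ.map_star]; simp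
  re_inner_nonneg a := (Complex.nonneg_iff.1 (hτ.nonneg a)).1
  add_left a b c := by simp [add_mul]
  smul_left a b c := by simp

theorem norm2_add_le (a b : A) : norm2 τ (a + b) ≤ norm2 τ a + norm2 τ b :=
  @norm_add_le A (@InnerProductSpace.Core.toSeminormedAddCommGroup ℂ A _ _ _ hτ.core).toSeminormedAddGroup a b

theorem norm_map_star_mul_le (a b : A) : ‖τ (star a * b)‖ ≤ norm2 τ a * norm2 τ b :=
  @InnerProductSpace.Core.norm_inner_le_norm ℂ A _ _ _ hτ.core a b

theorem norm2_one : norm2 τ 1 = 1 := by simp [norm2, hτ.map_one]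

theorem norm_map_le_norm2 (a : A) : ‖τ a‖ ≤ norm2 τ a := by
  simpa [hτ.norm2_one] using hτ.norm_map_star_mul_le 1 a

theorem sq_norm2 (a : A) : norm2 τ a ^ 2 = (τ (star a * a)).re :=
  Real.sq_sqrt (Complex.nonneg_iff.1 (hτ.nonneg a)).1

theorem norm2_star (a : A) : norm2 τ (star a) = norm2 τ a := by
  rw [norm2, norm2, star_star, hτ.tracial]

/-- Writing `‖a‖² - a* a = d* d` turns the claim into positivity of `τ` on `(d b)* (d b)`. -/
theorem norm2_mul_le (a b : A) : norm2 τ (a * b) ≤ ‖a‖ * norm2 τ b := by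
  let _ := CStarAlgebra.spectralOrder A
  have := CStarAlgebra.spectralOrderedRing A
  have h : star a * a ≤ algebraMap ℝ A (‖a‖ ^ 2) := CStarAlgebra.star_mul_le_algebraMap_norm_sq
  obtain ⟨d, hd⟩ := CStarAlgebra.nonneg_iff_eq_star_mul_self.1 (sub_nonneg.2 h)
  have e : star (a * b) * (a * b) = ((‖a‖ ^ 2 : ℝ) : ℂ) • (star b * b) - star (d * b) * (d * b) := by
    have h1 : star (d * b) * (d * b) = star b * (star d * d) * b := by
      rw [star_mul]; noncomm_ring
    rw [h1, ← hd, Complex.coe_smul, Algebra.algebraMap_eq_smul_one, star_mul]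
    simp only [mul_sub, sub_mul, mul_smul_comm, mul_one, smul_mul_assoc]
    rw [sub_sub_cancel]; noncomm_ring
  have h2 := (Complex.nonneg_iff.1 (hτ.nonneg (d * b))).1
  apply Real.sqrt_le_iff.2
  refine ⟨mul_nonneg (norm_nonneg _) (Real.sqrt_nonneg _), ?_⟩
  rw [mul_pow, hτ.sq_norm2, e, map_sub, map_smul, smul_eq_mul, Complex.sub_re, Complex.re_ofReal_mul]
  linarith

theorem norm2_mul_le' (a b : A) : norm2 τ (a * b) ≤ norm2 τ a * ‖b‖ := by
  have := hτ.norm2_mul_le (star b) (star a)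
  rw [← star_mul, hτ.norm2_star, hτ.norm2_star, norm_star] at this
  linarith

theorem norm2_le_norm (a : A) : norm2 τ a ≤ ‖a‖ := by
  simpa [hτ.norm2_one] using hτ.norm2_mul_le a 1

theorem norm_map_le_norm (a : A) : ‖τ a‖ ≤ ‖a‖ :=
  (hτ.norm_map_le_norm2 a).trans (hτ.norm2_le_norm a)

end IsTracialState

section

variable {A : Type*} [CStarAlgebra A] {τ : A →ₗ[ℂ] ℂ}

theorem norm2_nonneg (a : A) : 0 ≤ norm2 τ a := Real.sqrt_nonneg _

theorem norm2_zero : norm2 τ 0 = 0 := by simp [norm2]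

theorem norm2_smul (c : ℂ) (a : A) : norm2 τ (c • a) = ‖c‖ * norm2 τ a := by
  have : star (c • a) * (c • a) = ((‖c‖ ^ 2 : ℝ) : ℂ) • (star a * a) := by
    rw [star_smul, smul_mul_smul_comm, Complex.star_def, Complex.conj_mul']; simp
  rw [norm2, this, map_smul, smul_eq_mul, Complex.re_ofReal_mul, Real.sqrt_mul (by positivity),
    Real.sqrt_sq (norm_nonneg _), norm2]

theorem norm2_neg (a : A) : norm2 τ (-a) = norm2 τ a := by simp [norm2]

theorem norm2_sub_comm (a b : A) : norm2 τ (a - b) = norm2 τ (b - a) := by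
  rw [← norm2_neg, neg_sub]

theorem IsTracialState.norm2_sub_le (hτ : IsTracialState τ) (a b c : A) :
    norm2 τ (a - c) ≤ norm2 τ (a - b) + norm2 τ (b - c) := by
  simpa using hτ.norm2_add_le (a - b) (b - c)

theorem norm2_unitary_conj (hτ : IsTracialState τ) {u : A} (hu : u ∈ unitary A) (a : A) :
    norm2 τ (u * a * star u) = norm2 τ a := by
  have : star (u * a * star u) * (u * a * star u) = u * (star a * a * star u) := by
    simp only [star_mul, star_star, mul_assoc]
    rw [← mul_assoc (star u) u, Unitary.star_mul_self_of_mem hu, one_mul]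
  rw [norm2, this, hτ.tracial, mul_assoc, Unitary.star_mul_self_of_mem hu, mul_one, norm2]

end

/-! ### Evaluation of non-commutative polynomials -/

section

variable {K : Type*}

theorem lift_ncStar {A : Type*} [CStarAlgebra A] {Y : K → A} (hY : ∀ k, IsSelfAdjoint (Y k))
    (p : FreeAlgebra ℂ K) : FreeAlgebra.lift ℂ Y (ncStar p) = star (FreeAlgebra.lift ℂ Y p) := by
  induction p using FreeAlgebra.induction with
  | grade0 c => rw [ncStar_algebraMap, AlgHom.commutes, AlgHom.commutes]; exact algebraMap_star_comm c
  | grade1 k => rw [ncStar_ι, FreeAlgebra.lift_ι_apply, (hY k).star_eq]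
  | mul p q hp hq => rw [ncStar_mul, map_mul, map_mul, hp, hq, star_mul]
  | add p q hp hq => rw [ncStar_add, map_add, map_add, hp, hq, star_add]

/-- The point is uniformity: `C` depends on `R` and `p` only, so one bound serves the tuple in `M`
and matrices of all sizes. -/
theorem exists_norm_lift_le (R : K → ℝ) (p : FreeAlgebra ℂ K) : ∃ C : ℝ, 0 ≤ C ∧
    ∀ (A : Type*) [CStarAlgebra A] (Y : K → A), (∀ k, ‖Y k‖ ≤ R k) →
      ‖FreeAlgebra.lift ℂ Y p‖ ≤ C := by
  induction p using FreeAlgebra.induction with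
  | grade0 c =>
    refine ⟨‖c‖, norm_nonneg _, fun A _ Y _ => ?_⟩
    rw [AlgHom.commutes, Algebra.algebraMap_eq_smul_one, norm_smul]
    rcases subsingleton_or_nontrivial A with h | h
    · rw [Subsingleton.elim (1 : A) 0, norm_zero, mul_zero]; exact norm_nonneg _
    · rw [CStarRing.norm_one, mul_one]
  | grade1 k =>
    refine ⟨|R k|, abs_nonneg _, fun A _ Y h => ?_⟩
    rw [FreeAlgebra.lift_ι_apply]; exact (h k).trans (le_abs_self _)
  | mul p q hp hq =>
    obtain ⟨C, hC, h1⟩ := hp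
    obtain ⟨D, hD, h2⟩ := hq
    refine ⟨C * D, mul_nonneg hC hD, fun A _ Y h => ?_⟩
    rw [map_mul]
    exact (norm_mul_le _ _).trans (mul_le_mul (h1 A Y h) (h2 A Y h) (norm_nonneg _) hC)
  | add p q hp hq =>
    obtain ⟨C, hC, h1⟩ := hp
    obtain ⟨D, hD, h2⟩ := hq
    refine ⟨C + D, add_nonneg hC hD, fun A _ Y h => ?_⟩
    rw [map_add]
    exact (norm_add_le _ _).trans (add_le_add (h1 A Y h) (h2 A Y h))

/-- Products are handled by `ab - cd = (a - c) b + c (b - d)`, with the operator norms controlled by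
`exists_norm_lift_le`. Only the finitely many variables occurring in `p` matter, and `L` is
independent of the algebra and the trace. -/
theorem exists_norm2_lift_sub_le (R : K → ℝ) (p : FreeAlgebra ℂ K) :
    ∃ (F : Finset K) (L : ℝ), 0 ≤ L ∧ ∀ (A : Type*) [CStarAlgebra A] (τ : A →ₗ[ℂ] ℂ)
      (_ : IsTracialState τ) (Y Z : K → A), (∀ k, ‖Y k‖ ≤ R k) → (∀ k, ‖Z k‖ ≤ R k) →
      ∀ δ, 0 ≤ δ → (∀ k ∈ F, norm2 τ (Y k - Z k) ≤ δ) →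
      norm2 τ (FreeAlgebra.lift ℂ Y p - FreeAlgebra.lift ℂ Z p) ≤ L * δ := by
  classical
  induction p using FreeAlgebra.induction with
  | grade0 c =>
    refine ⟨∅, 0, le_rfl, fun A _ τ hτ Y Z _ _ δ _ _ => ?_⟩
    rw [AlgHom.commutes, AlgHom.commutes, sub_self, norm2_zero, zero_mul]
  | grade1 k =>
    refine ⟨{k}, 1, zero_le_one, fun A _ τ hτ Y Z _ _ δ _ h => ?_⟩
    rw [FreeAlgebra.lift_ι_apply, FreeAlgebra.lift_ι_apply, one_mul]
    exact h k (Finset.mem_singleton_self k)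
  | mul p q hp hq =>
    obtain ⟨F, L, hL, h1⟩ := hp
    obtain ⟨G, N, hN, h2⟩ := hq
    obtain ⟨C, hC, h3⟩ := exists_norm_lift_le R p
    obtain ⟨D, hD, h4⟩ := exists_norm_lift_le R q
    refine ⟨F ∪ G, L * D + C * N, by positivity, fun A _ τ hτ Y Z hY hZ δ hδ h => ?_⟩
    have h5 := h1 A τ hτ Y Z hY hZ δ hδ fun k hk => h k (Finset.mem_union_left _ hk)
    have h6 := h2 A τ hτ Y Z hY hZ δ hδ fun k hk => h k (Finset.mem_union_right _ hk)
    rw [map_mul, map_mul]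
    set a := FreeAlgebra.lift ℂ Y p
    set b := FreeAlgebra.lift ℂ Y q
    set c := FreeAlgebra.lift ℂ Z p
    set d := FreeAlgebra.lift ℂ Z q
    have e : a * b - c * d = (a - c) * b + c * (b - d) := by noncomm_ring
    rw [e]
    calc _ ≤ norm2 τ (a - c) * ‖b‖ + ‖c‖ * norm2 τ (b - d) :=
          (hτ.norm2_add_le _ _).trans (add_le_add (hτ.norm2_mul_le' _ _) (hτ.norm2_mul_le _ _))
      _ ≤ (L * δ) * D + C * (N * δ) :=
          add_le_add (mul_le_mul h5 (h4 A Y hY) (norm_nonneg _) (by positivity))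
            (mul_le_mul (h3 A Z hZ) h6 (norm2_nonneg _) hC)
      _ = _ := by ring
  | add p q hp hq =>
    obtain ⟨F, L, hL, h1⟩ := hp
    obtain ⟨G, N, hN, h2⟩ := hq
    refine ⟨F ∪ G, L + N, add_nonneg hL hN, fun A _ τ hτ Y Z hY hZ δ hδ h => ?_⟩
    have h5 := h1 A τ hτ Y Z hY hZ δ hδ fun k hk => h k (Finset.mem_union_left _ hk)
    have h6 := h2 A τ hτ Y Z hY hZ δ hδ fun k hk => h k (Finset.mem_union_right _ hk)
    rw [map_add, map_add, add_sub_add_comm, add_mul]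
    exact (hτ.norm2_add_le _ _).trans (add_le_add h5 h6)

end

/-! ### Functional calculus -/

section

variable {A : Type*} [CStarAlgebra A]

theorem norm_cfc_le_of_norm_le {c : A} {C : ℝ} (hC : ‖c‖ ≤ C) {h : ℝ → ℝ}
    {s : ℝ} (hs : 0 ≤ s) (hh : ∀ t ∈ Set.Icc (-C) C, |h t| ≤ s) : ‖cfc h c‖ ≤ s := by
  rcases subsingleton_or_nontrivial A with h' | h'
  · rw [Subsingleton.elim (cfc h c) 0, norm_zero]; exact hs
  refine norm_cfc_le hs fun t ht => hh t ?_
  have := (spectrum.norm_le_norm_of_mem ht).trans hC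
  exact abs_le.1 this

/-- `D` is the functional calculus value `(1 + c²)⁻¹`; these algebraic facts are all that is later
needed about `2t / (1 + t²)`. -/
theorem exists_resolvent {c : A} (hc : IsSelfAdjoint c) : ∃ D : A,
    D * (1 + c * c) = 1 ∧ (1 + c * c) * D = 1 ∧ ‖D‖ ≤ 1 ∧ ‖D * c‖ ≤ 1 ∧ ‖c * D‖ ≤ 1 ∧
    cfc (fun t : ℝ => 2 * t / (1 + t * t)) c = (2 : ℝ) • (D * c) := by
  have hpos : ∀ t : ℝ, 0 < 1 + t * t := fun t => by nlinarith [mul_self_nonneg t]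
  have hp : ∀ t : ℝ, 1 + t * t ≠ 0 := fun t => (hpos t).ne'
  have hcont : Continuous fun t : ℝ => (1 + t * t)⁻¹ := by
    fun_prop (disch := exact hp)
  have hid : cfc (fun t : ℝ => t) c = c := cfc_id' ℝ c
  have hD : cfc (fun t : ℝ => (1 + t * t)⁻¹ * t) c = cfc (fun t : ℝ => (1 + t * t)⁻¹) c * c := by
    rw [cfc_mul (fun t : ℝ => (1 + t * t)⁻¹) (fun t => t) c hcont.continuousOn, hid]
  have hD' : cfc (fun t : ℝ => (1 + t * t)⁻¹ * t) c = c * cfc (fun t : ℝ => (1 + t * t)⁻¹) c := by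
    rw [show (fun t : ℝ => (1 + t * t)⁻¹ * t) = fun t => t * (1 + t * t)⁻¹ from
        funext fun t => mul_comm _ _,
      cfc_mul (fun t => t) (fun t : ℝ => (1 + t * t)⁻¹) c (by fun_prop) hcont.continuousOn, hid]
  have hq : cfc (fun t : ℝ => 1 + t * t) c = 1 + c * c := by
    rw [cfc_add c (fun _ => (1 : ℝ)) (fun t => t * t), cfc_const_one ℝ c,
      cfc_mul (fun t : ℝ => t) (fun t => t) c, hid]
  have hn : ‖cfc (fun t : ℝ => (1 + t * t)⁻¹ * t) c‖ ≤ 1 := by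
    refine norm_cfc_le_of_norm_le (c := c) le_rfl zero_le_one fun t _ => ?_
    rw [abs_mul, abs_inv, abs_of_pos (hpos t), inv_mul_le_iff₀ (hpos t)]
    nlinarith [abs_mul_abs_self t, sq_nonneg (|t| - 1), abs_nonneg t]
  refine ⟨cfc (fun t : ℝ => (1 + t * t)⁻¹) c, ?_, ?_, ?_, hD ▸ hn, hD' ▸ hn, ?_⟩
  · rw [← hq, ← cfc_mul _ _ c hcont.continuousOn]
    simp only [inv_mul_cancel₀ (hp _)]
    exact cfc_const_one ℝ c
  · rw [← hq, ← cfc_mul _ _ c (by fun_prop) hcont.continuousOn]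
    simp only [mul_inv_cancel₀ (hp _)]
    exact cfc_const_one ℝ c
  · refine norm_cfc_le_of_norm_le (c := c) le_rfl zero_le_one fun t _ => ?_
    rw [abs_inv, abs_of_pos (hpos t)]
    exact inv_le_one_of_one_le₀ (by nlinarith)
  · rw [← hD, ← cfc_smul (2 : ℝ) (fun t : ℝ => (1 + t * t)⁻¹ * t) c (hcont.mul continuous_id).continuousOn]
    congr 1; funext t; simp only [smul_eq_mul]; ring

/-- A resolvent identity expresses the difference through `c - b` flanked by contractions, with no
bound on `‖b‖` or `‖c‖`. This is why the approximant of `b` may have arbitrary operator norm. The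
constant is 2 from the factor in `2t`, times two terms. -/
theorem norm2_cfc_sub_le {τ : A →ₗ[ℂ] ℂ} (hτ : IsTracialState τ) {b c : A}
    (hb : IsSelfAdjoint b) (hc : IsSelfAdjoint c) :
    norm2 τ (cfc (fun t : ℝ => 2 * t / (1 + t * t)) c - cfc (fun t : ℝ => 2 * t / (1 + t * t)) b)
      ≤ 4 * norm2 τ (c - b) := by
  obtain ⟨D, hD1, hD2, hD3, hD4, hD5, hD6⟩ := exists_resolvent hc
  obtain ⟨E, hE1, hE2, hE3, hE4, hE5, hE6⟩ := exists_resolvent hb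
  have hcomm : E * b = b * E := by
    calc E * b = E * (b * ((1 + b * b) * E)) := by rw [hE2, mul_one]
      _ = (E * (1 + b * b)) * b * E := by noncomm_ring
      _ = b * E := by rw [hE1, one_mul]
  have key : D * c - E * b = D * (c - b) * E + (D * c) * (b - c) * (b * E) := by
    calc D * c - E * b = D * c * ((1 + b * b) * E) - (D * (1 + c * c)) * (b * E) := by
          rw [hE2, hD1, mul_one, one_mul, hcomm]
      _ = _ := by noncomm_ring
  have h1 : norm2 τ (D * (c - b) * E) ≤ norm2 τ (c - b) :=
    (hτ.norm2_mul_le' _ _).trans <| (mul_le_of_le_one_right (norm2_nonneg _) hE3).trans <|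
      (hτ.norm2_mul_le _ _).trans (mul_le_of_le_one_left (norm2_nonneg _) hD3)
  have h2 : norm2 τ ((D * c) * (b - c) * (b * E)) ≤ norm2 τ (c - b) := by
    rw [norm2_sub_comm c b]
    exact (hτ.norm2_mul_le' _ _).trans <| (mul_le_of_le_one_right (norm2_nonneg _) hE5).trans <|
      (hτ.norm2_mul_le _ _).trans (mul_le_of_le_one_left (norm2_nonneg _) hD4)
  rw [hD6, hE6, ← smul_sub, key, ← Complex.coe_smul, norm2_smul]
  have := (hτ.norm2_add_le _ _).trans (add_le_add h1 h2)
  norm_num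
  linarith

end

/-! ### Density of non-commutative polynomials in the generated von Neumann algebra -/

section Amplification

variable {H : Type*} [NormedAddCommGroup H] [InnerProductSpace ℂ H] {ι : Type*}

/-- The operator `m ⊗ 1` on `ℓ²(ι; H)`. -/
noncomputable def amplify (ι : Type*) (m : H →L[ℂ] H) :
    lp (fun _ : ι => H) 2 →L[ℂ] lp (fun _ : ι => H) 2 :=
  lp.mapCLM 2 (fun _ => m) (norm_nonneg m) fun _ => le_rfl

theorem amplify_apply (m : H →L[ℂ] H) (v : lp (fun _ : ι => H) 2) (i : ι) :
    amplify ι m v i = m (v i) := rfl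

theorem amplify_add (m n : H →L[ℂ] H) (v : lp (fun _ : ι => H) 2) :
    amplify ι (m + n) v = amplify ι m v + amplify ι n v := by
  ext i; simp [amplify_apply]

theorem amplify_smul (c : ℂ) (m : H →L[ℂ] H) (v : lp (fun _ : ι => H) 2) :
    amplify ι (c • m) v = c • amplify ι m v := by
  ext i; simp [amplify_apply]

theorem amplify_sub (m n : H →L[ℂ] H) (v : lp (fun _ : ι => H) 2) :
    amplify ι (m - n) v = amplify ι m v - amplify ι n v := by
  ext i; simp [amplify_apply]

theorem amplify_mul (m n : H →L[ℂ] H) (v : lp (fun _ : ι => H) 2) :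
    amplify ι (m * n) v = amplify ι m (amplify ι n v) := by
  ext i; simp [amplify_apply]

theorem amplify_one (v : lp (fun _ : ι => H) 2) : amplify ι (1 : H →L[ℂ] H) v = v := by
  ext i; simp [amplify_apply]

theorem amplify_single [DecidableEq ι] (m : H →L[ℂ] H) (i : ι) (h : H) :
    amplify ι m (lp.single 2 i h) = lp.single 2 i (m h) := by
  ext j
  rw [amplify_apply]
  by_cases hj : j = i
  · subst hj; simp
  · rw [lp.single_apply_ne _ _ _ hj, lp.single_apply_ne _ _ _ hj, map_zero]

variable [CompleteSpace H]

theorem amplify_inner_of_isSelfAdjoint {m : H →L[ℂ] H} (hm : IsSelfAdjoint m)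
    (v w : lp (fun _ : ι => H) 2) : ⟪v, amplify ι m w⟫_ℂ = ⟪amplify ι m v, w⟫_ℂ := by
  rw [lp.inner_eq_tsum, lp.inner_eq_tsum]
  refine tsum_congr fun i => ?_
  rw [amplify_apply, amplify_apply, ← ContinuousLinearMap.adjoint_inner_left,
    ContinuousLinearMap.isSelfAdjoint_iff'.1 hm]

/-- As `X` is self-adjoint, `V` reduces every `m ⊗ 1`, so the matrix entries of its projection lie
in the commutant of `X`. An element of the double commutant commutes with these entries, hence its
amplification commutes with the projection. -/
theorem commute_starProjection_amplify {X : Set (H →L[ℂ] H)}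
    {V : Submodule ℂ (lp (fun _ : ι => H) 2)} [V.HasOrthogonalProjection]
    (hX : ∀ m ∈ X, IsSelfAdjoint m) (hV : ∀ m ∈ X, ∀ v ∈ V, amplify ι m v ∈ V)
    {a : H →L[ℂ] H} (ha : a ∈ wStar X) (v : lp (fun _ : ι => H) 2) :
    V.starProjection (amplify ι a v) = amplify ι a (V.starProjection v) := by
  classical
  have hcomm : ∀ m ∈ X, ∀ v, V.starProjection (amplify ι m v) = amplify ι m (V.starProjection v) := by
    intro m hm v
    refine (V.eq_starProjection_of_mem_of_inner_eq_zero
      (hV m hm _ (V.starProjection_apply_mem v)) fun w hw => ?_)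
    rw [← map_sub, ← amplify_inner_of_isSelfAdjoint (hX m hm)]
    exact V.starProjection_inner_eq_zero v _ (hV m hm w hw)
  have hentry : ∀ i j : ι, ∀ h : H,
      V.starProjection (lp.single 2 j (a h)) i = a (V.starProjection (lp.single 2 j h) i) := by
    intro i j h
    set T : H →L[ℂ] H := (lp.evalCLM ℂ (fun _ : ι => H) 2 i).comp
      (V.starProjection.comp (lp.singleContinuousLinearMap ℂ (fun _ : ι => H) 2 j)) with hT
    have hTa : ∀ h, T h = V.starProjection (lp.single 2 j h) i := fun h => rfl
    have hTX : ∀ m ∈ X, m * T = T * m := by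
      intro m hm
      ext h
      rw [mul_apply_eq_comp, mul_apply_eq_comp, hTa, hTa,
        ← amplify_single, hcomm m hm, amplify_apply]
    have hTc : T ∈ StarSubalgebra.centralizer ℂ X := by
      rw [StarSubalgebra.mem_centralizer_iff]
      exact fun m hm => ⟨hTX m hm, by rw [(hX m hm).star_eq]; exact hTX m hm⟩
    have h1 := ((StarSubalgebra.mem_centralizer_iff ℂ).1 ha T hTc).1
    have h2 := congrArg (fun m : H →L[ℂ] H => m h) h1
    exact h2
  have hext : V.starProjection.comp (amplify ι a) = (amplify ι a).comp V.starProjection := by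
    refine lp.ext_continuousLinearMap (by simp) fun j => ?_
    ext h i
    simp only [ContinuousLinearMap.comp_apply, lp.singleContinuousLinearMap_apply, amplify_single,
      amplify_apply]
    exact hentry i j h
  exact congrArg (fun m : _ →L[ℂ] _ => m v) hext

/-- Let `V` be the closure of the vectors `(p(x) ⊗ 1) ζ`. It is invariant and contains `ζ`, so
commutation with its projection forces `(a ⊗ 1) ζ ∈ V`. -/
theorem exists_norm_amplify_lift_sub_lt {K : Type*} {x : K → H →L[ℂ] H}
    (hx : ∀ k, IsSelfAdjoint (x k)) {a : H →L[ℂ] H} (ha : a ∈ wStar (Set.range x))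
    (ζ : lp (fun _ : ι => H) 2) {δ : ℝ} (hδ : 0 < δ) :
    ∃ p : FreeAlgebra ℂ K, ‖amplify ι (FreeAlgebra.lift ℂ x p - a) ζ‖ < δ := by
  let f : FreeAlgebra ℂ K →ₗ[ℂ] lp (fun _ : ι => H) 2 :=
    { toFun := fun p => amplify ι (FreeAlgebra.lift ℂ x p) ζ
      map_add' := fun p q => by rw [map_add, amplify_add]
      map_smul' := fun c p => by rw [map_smul, amplify_smul]; rfl }
  let V := (LinearMap.range f).topologicalClosure
  have hVc : IsClosed (V : Set (lp (fun _ : ι => H) 2)) := Submodule.isClosed_topologicalClosure _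
  have : CompleteSpace V := hVc.completeSpace_coe
  have hV : ∀ m ∈ Set.range x, ∀ v ∈ V, amplify ι m v ∈ V := by
    rintro _ ⟨k, rfl⟩ v hv
    refine map_mem_closure (amplify ι (x k)).continuous hv ?_
    rintro _ ⟨p, rfl⟩
    refine ⟨FreeAlgebra.ι ℂ k * p, ?_⟩
    change amplify ι (FreeAlgebra.lift ℂ x (FreeAlgebra.ι ℂ k * p)) ζ = _
    rw [map_mul, FreeAlgebra.lift_ι_apply, amplify_mul]
    rfl
  have hζ : ζ ∈ V := by
    refine subset_closure ⟨1, ?_⟩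
    change amplify ι (FreeAlgebra.lift ℂ x 1) ζ = _
    rw [map_one, amplify_one]
  have h1 := commute_starProjection_amplify (V := V) (by rintro _ ⟨k, rfl⟩; exact hx k) hV ha ζ
  rw [V.starProjection_eq_self_iff.2 hζ, V.starProjection_eq_self_iff] at h1
  obtain ⟨_, ⟨p, rfl⟩, hp⟩ := Metric.mem_closure_iff.1 h1 δ hδ
  refine ⟨p, ?_⟩
  rw [dist_comm, dist_eq_norm] at hp
  rw [amplify_sub]
  exact hp

end Amplification

/-! ### Density in the 2-norm of a tracial von Neumann algebra -/

section

variable {H : Type*} [NormedAddCommGroup H] [InnerProductSpace ℂ H] [CompleteSpace H]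

instance VonNeumannAlgebra.isClosed (M : VonNeumannAlgebra H) :
    IsClosed (M.toStarSubalgebra : Set (H →L[ℂ] H)) := by
  have := Set.isClosed_centralizer (Set.centralizer (M : Set (H →L[ℂ] H)))
  rwa [M.centralizer_centralizer] at this

variable {M : VonNeumannAlgebra H} (τ : TracialState M)

theorem TracialState.isTracialState : IsTracialState τ.toLin where
  map_one := τ.map_one
  nonneg a := τ.nonneg _ (star_mul_self_nonneg (a : H →L[ℂ] H))
  tracial := τ.tracial

/-- The vector concatenates the two sequences `ξ`, `η` given by normality. Then `‖a‖₂² = Re ∑ ⟪a η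
k, a ξ k⟫`, which is at most `∑ (‖a ξ k‖² + ‖a η k‖²)`. -/
theorem TracialState.exists_vector : ∃ ζ : lp (fun _ : ℕ ⊕ ℕ => H) 2,
    ∀ a : M.toStarSubalgebra, norm2 τ.toLin a ≤ ‖amplify (ℕ ⊕ ℕ) (a : H →L[ℂ] H) ζ‖ := by
  obtain ⟨ξ, η, hξ, hη, h⟩ := τ.normal
  have hmem : Memℓp (Sum.elim ξ η) 2 := by
    refine memℓp_gen ?_
    simp only [ENNReal.toReal_ofNat, Real.rpow_ofNat]
    exact Summable.sum _ hξ hη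
  refine ⟨⟨Sum.elim ξ η, hmem⟩, fun a => ?_⟩
  set ζ : lp (fun _ : ℕ ⊕ ℕ => H) 2 := ⟨Sum.elim ξ η, hmem⟩
  have h1 := (lp.hasSum_norm (p := 2) (by simp) (amplify (ℕ ⊕ ℕ) (a : H →L[ℂ] H) ζ))
  simp only [ENNReal.toReal_ofNat, Real.rpow_ofNat] at h1
  have h2 := Complex.hasSum_re (h (star a * a))
  refine Real.sqrt_le_iff.2 ⟨norm_nonneg _, ?_⟩
  have hl := (h1.summable.comp_injective Sum.inl_injective)
  have hr := (h1.summable.comp_injective Sum.inr_injective)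
  rw [← (hl.hasSum.sum hr.hasSum).unique h1]
  refine hasSum_le (fun k => ?_) h2 (hl.hasSum.add hr.hasSum)
  have e : ⟪η k, ((star a * a : M.toStarSubalgebra) : H →L[ℂ] H) (ξ k)⟫_ℂ =
      ⟪(a : H →L[ℂ] H) (η k), (a : H →L[ℂ] H) (ξ k)⟫_ℂ := by
    change ⟪η k, (ContinuousLinearMap.adjoint (a : H →L[ℂ] H)) ((a : H →L[ℂ] H) (ξ k))⟫_ℂ = _
    rw [ContinuousLinearMap.adjoint_inner_right]
  rw [e]
  change _ ≤ ‖(a : H →L[ℂ] H) (ξ k)‖ ^ 2 + ‖(a : H →L[ℂ] H) (η k)‖ ^ 2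
  have h3 := re_inner_le_norm (𝕜 := ℂ) ((a : H →L[ℂ] H) (η k)) ((a : H →L[ℂ] H) (ξ k))
  have h4 := two_mul_le_add_sq ‖(a : H →L[ℂ] H) (η k)‖ ‖(a : H →L[ℂ] H) (ξ k)‖
  have h5 := mul_nonneg (norm_nonneg ((a : H →L[ℂ] H) (η k)))
    (norm_nonneg ((a : H →L[ℂ] H) (ξ k)))
  refine h3.trans ?_
  linarith

theorem coe_lift {K : Type*} (z : K → M.toStarSubalgebra) (p : FreeAlgebra ℂ K) :
    ((FreeAlgebra.lift ℂ z p : M.toStarSubalgebra) : H →L[ℂ] H) =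
      FreeAlgebra.lift ℂ (fun k => (z k : H →L[ℂ] H)) p := by
  have : (M.toStarSubalgebra.subtype.toAlgHom.comp (FreeAlgebra.lift ℂ z)) =
      FreeAlgebra.lift ℂ (fun k => (z k : H →L[ℂ] H)) := by
    ext k; simp
  exact congrArg (fun g => g p) this

theorem TracialState.exists_norm2_lift_sub_lt {K : Type*} {z : K → M.toStarSubalgebra}
    (hz : ∀ k, IsSelfAdjoint (z k)) {a : M.toStarSubalgebra}
    (ha : (a : H →L[ℂ] H) ∈ wStarTuple z) {δ : ℝ} (hδ : 0 < δ) :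
    ∃ p : FreeAlgebra ℂ K, norm2 τ.toLin (FreeAlgebra.lift ℂ z p - a) < δ := by
  obtain ⟨ζ, hζ⟩ := τ.exists_vector
  obtain ⟨p, hp⟩ := exists_norm_amplify_lift_sub_lt (x := fun k => (z k : H →L[ℂ] H))
    (fun k => congrArg Subtype.val (hz k)) ha ζ hδ
  refine ⟨p, (hζ _).trans_lt ?_⟩
  rw [← coe_lift] at hp
  exact hp

end

/-! ### Norm-bounded approximation by non-commutative polynomials -/

section

variable {K : Type*}

theorem lift_aeval {A : Type*} [CStarAlgebra A] (Y : K → A) (p : FreeAlgebra ℂ K)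
    (h : Polynomial ℝ) :
    FreeAlgebra.lift ℂ Y (Polynomial.aeval p h) = Polynomial.aeval (FreeAlgebra.lift ℂ Y p) h :=
  (Polynomial.aeval_algHom_apply ((FreeAlgebra.lift ℂ Y).restrictScalars ℝ) p h).symm

theorem isSelfAdjoint_lift_symmetrization {A : Type*} [CStarAlgebra A] {Y : K → A}
    (hY : ∀ k, IsSelfAdjoint (Y k)) (p : FreeAlgebra ℂ K) :
    IsSelfAdjoint (FreeAlgebra.lift ℂ Y ((2 : ℂ)⁻¹ • (p + ncStar p))) := by
  rw [map_smul, map_add, lift_ncStar hY, isSelfAdjoint_iff, star_smul,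
    (IsSelfAdjoint.add_star_self _).star_eq]
  simp

theorem isSelfAdjoint_aeval_and_norm_le {A : Type*} [CStarAlgebra A] {c : A}
    (hc : IsSelfAdjoint c) {C s : ℝ} (hC : ‖c‖ ≤ C) (hs : 0 ≤ s) {h : Polynomial ℝ}
    (hh : ∀ t ∈ Set.Icc (-C) C, |h.eval t| ≤ 1) :
    IsSelfAdjoint ((s : ℂ) • Polynomial.aeval c h) ∧ ‖(s : ℂ) • Polynomial.aeval c h‖ ≤ s := by
  rw [← cfc_polynomial h c]
  refine ⟨?_, ?_⟩
  · rw [Complex.coe_smul]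
    exact IsSelfAdjoint.smul (IsSelfAdjoint.all s) (cfc_predicate h.eval c)
  · rw [norm_smul, Complex.norm_real, Real.norm_of_nonneg hs]
    exact mul_le_of_le_one_right hs (norm_cfc_le_of_norm_le hC zero_le_one hh)

theorem abs_two_mul_div_le (t : ℝ) : |2 * t / (1 + t * t)| ≤ 1 := by
  have : 0 < 1 + t * t := by nlinarith [mul_self_nonneg t]
  rw [abs_div, abs_of_pos this, div_le_one this, abs_le]
  constructor <;> nlinarith [mul_self_nonneg (t - 1), mul_self_nonneg (t + 1)]

theorem continuous_two_mul_div : Continuous fun t : ℝ => 2 * t / (1 + t * t) := by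
  have hp : ∀ t : ℝ, 1 + t * t ≠ 0 := fun t => by nlinarith [mul_self_nonneg t]
  fun_prop (disch := exact hp)

theorem exists_polynomial_near_two_mul_div (C : ℝ) {η : ℝ} (h0 : 0 < η) (h1 : η ≤ 1) :
    ∃ h : Polynomial ℝ, (∀ t ∈ Set.Icc (-C) C, |h.eval t| ≤ 1) ∧
      ∀ t ∈ Set.Icc (-C) C, |h.eval t - 2 * t / (1 + t * t)| ≤ 2 * η := by
  -- Shrinking the target by `1 - η` leaves room for the Weierstrass error `η`, so `h` stays bounded
  -- by 1; the two errors add up to `2 * η`.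
  obtain ⟨h, hh⟩ := exists_polynomial_near_of_continuousOn (-C) C
    (fun t => (1 - η) * (2 * t / (1 + t * t)))
    (continuous_const.mul continuous_two_mul_div).continuousOn η h0
  refine ⟨h, fun t ht => ?_, fun t ht => ?_⟩ <;>
  · have h1 := abs_lt.1 (hh t ht)
    have h2 := abs_le.1 (abs_two_mul_div_le t)
    rw [abs_le]; constructor <;> nlinarith

theorem norm2_aeval_sub_cfc_le {A : Type*} [CStarAlgebra A] {τ : A →ₗ[ℂ] ℂ}
    (hτ : IsTracialState τ) {b c : A} (hb : IsSelfAdjoint b) (hc : IsSelfAdjoint c) {C η : ℝ}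
    (hC : ‖c‖ ≤ C) (hη : 0 ≤ η) {h : Polynomial ℝ}
    (hh : ∀ t ∈ Set.Icc (-C) C, |h.eval t - 2 * t / (1 + t * t)| ≤ 2 * η) :
    norm2 τ (Polynomial.aeval c h - cfc (fun t : ℝ => 2 * t / (1 + t * t)) b)
      ≤ 2 * η + 4 * norm2 τ (c - b) := by
  refine (hτ.norm2_sub_le _ (cfc (fun t : ℝ => 2 * t / (1 + t * t)) c) _).trans
    (add_le_add ((hτ.norm2_le_norm _).trans ?_) (norm2_cfc_sub_le hτ hb hc))
  rw [← cfc_polynomial h c, ← cfc_sub h.eval (fun t : ℝ => 2 * t / (1 + t * t)) c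
    h.continuous.continuousOn continuous_two_mul_div.continuousOn]
  exact norm_cfc_le_of_norm_le hC (by positivity) hh

end

/-! ### Bounded approximation inside the generated von Neumann algebra -/

section

variable {H : Type*} [NormedAddCommGroup H] [InnerProductSpace ℂ H] [CompleteSpace H]

theorem cfc_mem_wStar {X : Set (H →L[ℂ] H)} {a : H →L[ℂ] H} (ha : a ∈ wStar X) (f : ℝ → ℝ) :
    cfc f a ∈ wStar X := by
  refine (StarSubalgebra.mem_centralizer_iff ℂ).2 fun g hg => ?_
  obtain ⟨h1, h2⟩ := (StarSubalgebra.mem_centralizer_iff ℂ).1 ha g hg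
  exact ⟨(Commute.cfc_real (b := g) h1.symm f).symm.eq,
    (Commute.cfc_real (b := star g) h2.symm f).symm.eq⟩

/-- The function `t / (1 + √(1 - t²))` is a right inverse of `2t / (1 + t²)` on `[-1, 1]`, so
applying it to `a` gives `b`; the equation is the latter relation with denominators cleared. -/
theorem exists_two_smul_eq {X : Set (H →L[ℂ] H)} {a : H →L[ℂ] H} (ha : a ∈ wStar X)
    (hs : IsSelfAdjoint a) (hn : ‖a‖ ≤ 1) :
    ∃ b ∈ wStar X, IsSelfAdjoint b ∧ (2 : ℝ) • b = (1 + b * b) * a := by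
  -- `√` vanishes on negative reals, so the denominator is positive and the function continuous on
  -- all of `ℝ`.
  have hpos : ∀ t : ℝ, 0 < 1 + √(1 - t ^ 2) := fun t => by positivity
  have hcont : Continuous fun t : ℝ => t / (1 + √(1 - t ^ 2)) := by
    fun_prop (disch := exact fun t => (hpos t).ne')
  set f : ℝ → ℝ := fun t => t / (1 + √(1 - t ^ 2)) with hf
  refine ⟨cfc f a, cfc_mem_wStar ha f, cfc_predicate f a, ?_⟩
  have hid : cfc (fun t : ℝ => t) a = a := cfc_id' ℝ a
  have e1 : cfc (fun t : ℝ => (1 + f t * f t) * t) a = (1 + cfc f a * cfc f a) * a := by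
    rw [cfc_mul (fun t : ℝ => 1 + f t * f t) (fun t => t) a
        (by exact (continuous_const.add (hcont.mul hcont)).continuousOn) continuousOn_id, hid,
      cfc_add a (fun _ => (1 : ℝ)) (fun t => f t * f t) continuousOn_const
        (hcont.mul hcont).continuousOn, cfc_const_one ℝ a,
      cfc_mul f f a hcont.continuousOn hcont.continuousOn]
  rw [← e1, ← cfc_smul (2 : ℝ) f a hcont.continuousOn]
  refine cfc_congr fun t ht => ?_
  rcases subsingleton_or_nontrivial (H →L[ℂ] H) with h' | h'
  · exact absurd ht (by rw [spectrum.of_subsingleton]; exact Set.notMem_empty t)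
  have h1 : ‖t‖ ≤ 1 := (spectrum.norm_le_norm_of_mem ht).trans hn
  have h2 : t ^ 2 ≤ 1 := (sq_le_one_iff_abs_le_one t).2 h1
  have h3 := Real.sq_sqrt (sub_nonneg.2 h2)
  simp only [smul_eq_mul, hf]
  have h4 := (hpos t).ne'
  field_simp
  linear_combination (-t) * h3

variable {M : VonNeumannAlgebra H} (τ : TracialState M)

theorem wStarTuple_le {I : Type*} (x : I → M.toStarSubalgebra) : wStarTuple x ≤ M := by
  rw [wStarTuple, wStar_le_iff]
  rintro _ ⟨i, rfl⟩
  exact (x i).2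

/-- A bounded version of the density of non-commutative polynomials, in the spirit of the
Kaplansky density theorem. -/
theorem TracialState.exists_bounded_approx {K : Type*} {z : K → M.toStarSubalgebra} {T : K → ℝ}
    (hz : IsCutoff T z) {a : M.toStarSubalgebra} (ha : (a : H →L[ℂ] H) ∈ wStarTuple z)
    (hsa : IsSelfAdjoint a) {s : ℝ} (hs : 0 < s) (has : ‖(a : H →L[ℂ] H)‖ ≤ s)
    {δ : ℝ} (hδ : 0 < δ) :
    ∃ f : FreeAlgebra ℂ K, ‖FreeAlgebra.lift ℂ z f‖ ≤ s ∧
      norm2 τ.toLin (FreeAlgebra.lift ℂ z f - a) < δ ∧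
      ∀ (B : Type*) [CStarAlgebra B] (Y : K → B), (∀ k, IsSelfAdjoint (Y k)) →
        (∀ k, ‖Y k‖ ≤ T k) →
        IsSelfAdjoint (FreeAlgebra.lift ℂ Y f) ∧ ‖FreeAlgebra.lift ℂ Y f‖ ≤ s := by
  have hτ := τ.isTracialState
  have hzs : ∀ k, IsSelfAdjoint (z k) := fun k => (hz k).2.1
  have hzn : ∀ k, ‖z k‖ ≤ T k := fun k => (hz k).2.2
  have hsa' : IsSelfAdjoint (a : H →L[ℂ] H) := congrArg Subtype.val hsa
  obtain ⟨b', hb', hbs', hb2'⟩ := exists_two_smul_eq (a := s⁻¹ • (a : H →L[ℂ] H))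
    (by
      rw [← Complex.coe_smul]
      exact (wStarTuple z).toStarSubalgebra.smul_mem ha _)
    (IsSelfAdjoint.smul (IsSelfAdjoint.all _) hsa')
    (by rw [norm_smul, norm_inv, Real.norm_of_nonneg hs.le, inv_mul_le_iff₀ hs, mul_one]; exact has)
  set b : M.toStarSubalgebra := ⟨b', wStarTuple_le z hb'⟩ with hb
  have hbs : IsSelfAdjoint b := Subtype.ext hbs'
  have hb2 : (2 : ℝ) • b = (1 + b * b) * (s⁻¹ • a) := Subtype.ext hb2'
  have hGb : cfc (fun t : ℝ => 2 * t / (1 + t * t)) b = s⁻¹ • a := by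
    obtain ⟨D, hD1, -, -, -, -, hD6⟩ := exists_resolvent hbs
    rw [hD6, ← mul_smul_comm, hb2, ← mul_assoc, hD1, one_mul]
  -- The final error is at most `s * (2η + 4η) = 6sη`; the 7 makes the inequality strict.
  set η : ℝ := min 1 (δ / (7 * s)) with hη
  have hη0 : 0 < η := lt_min one_pos (by positivity)
  have hη1 : η ≤ 1 := min_le_left _ _
  have hη2 : 7 * s * η ≤ δ := by
    have := min_le_right 1 (δ / (7 * s))
    rw [le_div_iff₀ (by positivity)] at this
    linarith
  obtain ⟨p₀, hp₀⟩ := τ.exists_norm2_lift_sub_lt hzs (a := b) hb' hη0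
  -- Symmetrizing makes the value of `p` self-adjoint at every self-adjoint tuple, at no cost in the
  -- 2-norm estimate since `b` is self-adjoint.
  set p := (2 : ℂ)⁻¹ • (p₀ + ncStar p₀) with hp
  have hpb : norm2 τ.toLin (FreeAlgebra.lift ℂ z p - b) ≤ η := by
    have e : FreeAlgebra.lift ℂ z p - b = (2 : ℂ)⁻¹ • ((FreeAlgebra.lift ℂ z p₀ - b) +
        star (FreeAlgebra.lift ℂ z p₀ - b)) := by
      rw [hp, map_smul, map_add, lift_ncStar hzs, star_sub, hbs.star_eq, ← add_sub_add_comm,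
        smul_sub, ← two_smul ℂ b, smul_smul]
      norm_num
    rw [e, norm2_smul]
    have h1 := hτ.norm2_add_le (FreeAlgebra.lift ℂ z p₀ - b) (star (FreeAlgebra.lift ℂ z p₀ - b))
    rw [hτ.norm2_star] at h1
    have h2 : ‖(2 : ℂ)⁻¹‖ = 2⁻¹ := by norm_num
    rw [h2]
    linarith
  -- The bound is applied twice because `M` and the test algebra `B` may live in different
  -- universes. The interval `[-C, C]` then contains the spectra of all relevant values of `p`.
  obtain ⟨C₁, -, hC₁⟩ := exists_norm_lift_le T p
  obtain ⟨C₂, -, hC₂⟩ := exists_norm_lift_le T p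
  set C := max C₁ C₂
  obtain ⟨h, hh1, hh2⟩ := exists_polynomial_near_two_mul_div C hη0 hη1
  have hc : IsSelfAdjoint (FreeAlgebra.lift ℂ z p) := isSelfAdjoint_lift_symmetrization hzs p₀
  have hcC : ‖FreeAlgebra.lift ℂ z p‖ ≤ C := (hC₁ _ z hzn).trans (le_max_left _ _)
  refine ⟨(s : ℂ) • Polynomial.aeval p h, ?_, ?_, fun B _ Y hY hYn => ?_⟩
  · rw [map_smul, lift_aeval]
    exact (isSelfAdjoint_aeval_and_norm_le hc hcC hs.le hh1).2
  · rw [map_smul, lift_aeval]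
    set c := FreeAlgebra.lift ℂ z p
    have h1 := norm2_aeval_sub_cfc_le hτ hbs hc hcC hη0.le hh2
    have e : (s : ℂ) • Polynomial.aeval c h - a = (s : ℂ) • (Polynomial.aeval c h -
        cfc (fun t : ℝ => 2 * t / (1 + t * t)) b) := by
      rw [hGb, smul_sub, Complex.coe_smul, Complex.coe_smul, smul_inv_smul₀ hs.ne']
    rw [e, norm2_smul, Complex.norm_real, Real.norm_of_nonneg hs.le]
    nlinarith
  · rw [map_smul, lift_aeval]
    exact isSelfAdjoint_aeval_and_norm_le (isSelfAdjoint_lift_symmetrization hY p₀)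
      ((hC₂ B Y hYn).trans (le_max_right _ _)) hs.le hh1

end

/-! ### Substitution and unitary conjugation -/

section

variable {K K' : Type*}

theorem lift_lift {A : Type*} [Ring A] [Algebra ℂ A] (Y : K → A) (f : K' → FreeAlgebra ℂ K)
    (p : FreeAlgebra ℂ K') : FreeAlgebra.lift ℂ Y (FreeAlgebra.lift ℂ f p) =
      FreeAlgebra.lift ℂ (fun k => FreeAlgebra.lift ℂ Y (f k)) p := by
  have : (FreeAlgebra.lift ℂ Y).comp (FreeAlgebra.lift ℂ f) =
      FreeAlgebra.lift ℂ (fun k => FreeAlgebra.lift ℂ Y (f k)) := by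
    ext k; simp
  exact congrArg (fun g => g p) this

theorem lift_unitary_conj {A : Type*} [CStarAlgebra A] {u : A} (hu : u ∈ unitary A) (Y : K → A)
    (p : FreeAlgebra ℂ K) : FreeAlgebra.lift ℂ (fun k => u * Y k * star u) p =
      u * FreeAlgebra.lift ℂ Y p * star u := by
  have h1 := Unitary.mul_star_self_of_mem hu
  have h2 := Unitary.star_mul_self_of_mem hu
  induction p using FreeAlgebra.induction with
  | grade0 c => rw [AlgHom.commutes, AlgHom.commutes, ← Algebra.commutes, mul_assoc, h1, mul_one]
  | grade1 k => simp
  | mul p q hp hq =>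
    rw [map_mul, map_mul, hp, hq]
    calc _ = u * FreeAlgebra.lift ℂ Y p * (star u * u) * FreeAlgebra.lift ℂ Y q * star u := by
          noncomm_ring
      _ = _ := by rw [h2]; noncomm_ring
  | add p q hp hq => rw [map_add, map_add, hp, hq]; noncomm_ring

end

/-! ### Matrices -/

section

open scoped Matrix.Norms.L2Operator

/-- The normalized trace. -/
noncomputable def normalizedTrace (n : ℕ) : Matrix (Fin n) (Fin n) ℂ →ₗ[ℂ] ℂ :=
  (n : ℂ)⁻¹ • Matrix.traceLinearMap (Fin n) ℂ ℂ

theorem normalizedTrace_apply {n : ℕ} (A : Matrix (Fin n) (Fin n) ℂ) :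
    normalizedTrace n A = (n : ℂ)⁻¹ * A.trace := rfl

theorem isTracialState_normalizedTrace {n : ℕ} (hn : n ≠ 0) :
    IsTracialState (normalizedTrace n) where
  map_one := by
    rw [normalizedTrace_apply, Matrix.trace_one, Fintype.card_fin]
    exact inv_mul_cancel₀ (Nat.cast_ne_zero.2 hn)
  nonneg A := by
    rw [normalizedTrace_apply]
    refine mul_nonneg ?_ (Matrix.posSemidef_conjTranspose_mul_self A).trace_nonneg
    rw [← Complex.ofReal_natCast, ← Complex.ofReal_inv, Complex.zero_le_real]
    positivity
  tracial A B := by rw [normalizedTrace_apply, normalizedTrace_apply, Matrix.trace_mul_comm]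

theorem matrixNorm2_eq_norm2 {n : ℕ} (A : Matrix (Fin n) (Fin n) ℂ) :
    matrixNorm2 A = norm2 (normalizedTrace n) A := by
  rw [matrixNorm2, norm2, normalizedTrace_apply, ← Complex.ofReal_natCast, ← Complex.ofReal_inv,
    Complex.re_ofReal_mul]
  rfl

theorem matrixLaw_eq {K : Type*} {n : ℕ} (Y : K → Matrix (Fin n) (Fin n) ℂ)
    (p : FreeAlgebra ℂ K) : matrixLaw Y p = normalizedTrace n (FreeAlgebra.lift ℂ Y p) := rfl

theorem norm_lift_word_le {A : Type*} [CStarAlgebra A] [Nontrivial A] {K : Type*} {Y : K → A}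
    {R : K → ℝ} (hY : ∀ k, ‖Y k‖ ≤ R k) (w : List K) :
    ‖FreeAlgebra.lift ℂ Y (w.map (FreeAlgebra.ι ℂ)).prod‖ ≤ (w.map R).prod := by
  induction w with
  | nil => simp
  | cons k w ih =>
    simp only [List.map_cons, List.prod_cons, map_mul, FreeAlgebra.lift_ι_apply]
    exact (norm_mul_le _ _).trans
      (mul_le_mul (hY k) ih (norm_nonneg _) ((norm_nonneg _).trans (hY k)))

theorem matrixLaw_mem_lawSpace {K : Type*} {R : K → ℝ} {n : ℕ} (hn : n ≠ 0)
    {Y : K → Matrix (Fin n) (Fin n) ℂ} (hY : Y ∈ saMatrixTuples K n)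
    (hR : ∀ k, matrixOpNorm (Y k) ≤ R k) : matrixLaw Y ∈ lawSpace R := by
  have hτ := isTracialState_normalizedTrace hn
  have : NeZero n := ⟨hn⟩
  refine ⟨⟨fun p q => ?_, fun c p => ?_⟩, ?_, fun p => ?_, fun p q => ?_, fun w => ?_⟩
  · simp only [matrixLaw_eq, map_add]
  · simp only [matrixLaw_eq, map_smul]
  · rw [matrixLaw_eq, map_one, hτ.map_one]
  · rw [matrixLaw_eq, map_mul, lift_ncStar hY]
    exact hτ.nonneg _
  · rw [matrixLaw_eq, matrixLaw_eq, map_mul (FreeAlgebra.lift ℂ Y), hτ.tracial,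
      map_mul (FreeAlgebra.lift ℂ Y)]
  · exact (hτ.norm_map_le_norm _).trans (norm_lift_word_le (Y := Y) hR w)

end

/-! ### Comparison of orbital covering numbers -/

section

open scoped Matrix.Norms.L2Operator

variable {I I' : Type*}

/-- Two points close to the orbit of a common centre `c` are close up to conjugation by `u * star
v`. This allows centres to be moved into the covered set at the price of doubling the radius. -/
theorem norm2_sub_conj_lt {A : Type*} [CStarAlgebra A] {τ : A →ₗ[ℂ] ℂ} (hτ : IsTracialState τ)
    {u v : A} (hu : u ∈ unitary A) (hv : v ∈ unitary A) {a b c : A} {ε : ℝ}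
    (ha : norm2 τ (a - u * c * star u) < ε) (hb : norm2 τ (b - v * c * star v) < ε) :
    norm2 τ (a - (u * star v) * b * star (u * star v)) < 2 * ε := by
  have h1 := Unitary.star_mul_self_of_mem hv
  have e : u * c * star u - (u * star v) * b * star (u * star v) =
      (u * star v) * (v * c * star v - b) * star (u * star v) := by
    rw [mul_sub, sub_mul]
    congr 1
    calc u * c * star u = u * (star v * v) * c * (star v * v) * star u := by
          rw [h1, mul_one, mul_one]
      _ = _ := by rw [star_mul, star_star]; noncomm_ring
  have h2 := hτ.norm2_sub_le a (u * c * star u) ((u * star v) * b * star (u * star v))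
  rw [e, norm2_unitary_conj hτ (mul_mem hu (Unitary.star_mem hv)), norm2_sub_comm (v * c * star v)]
    at h2
  linarith

/-- Each centre `Z` of a cover of `Ω'` is replaced by some point of `Ω` related to a tuple near the
orbit of `Z`, if there is one. A relation `r` is used rather than a map because the new coordinates
also depend on the `J`-coordinates, which the projection has forgotten. -/
theorem orbCoveringNumber_le {n : ℕ} (hn : n ≠ 0) {F : Finset I} {F' : Finset I'} {ε ε' : ℝ}
    {Ω : Set (I → Matrix (Fin n) (Fin n) ℂ)} {Ω' : Set (I' → Matrix (Fin n) (Fin n) ℂ)}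
    (hΩ : Ω ⊆ saMatrixTuples I n)
    (r : (I → Matrix (Fin n) (Fin n) ℂ) → (I' → Matrix (Fin n) (Fin n) ℂ) → Prop)
    (hr : ∀ Y ∈ Ω, ∃ Y' ∈ Ω', r Y Y')
    (hlip : ∀ Y Z Y' Z', r Y Y' → r Z Z' → ∀ V ∈ Matrix.unitaryGroup (Fin n) ℂ,
      (∀ k ∈ F', matrixNorm2 (Y' k - V * Z' k * V.conjTranspose) < 2 * ε') →
      ∀ i ∈ F, matrixNorm2 (Y i - V * Z i * V.conjTranspose) < ε) :
    orbCoveringNumber F ε Ω ≤ orbCoveringNumber F' ε' Ω' := by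
  classical
  refine le_iInf₂ fun Ω₀ hΩ₀ => ?_
  let Q : (I' → Matrix (Fin n) (Fin n) ℂ) → (I → Matrix (Fin n) (Fin n) ℂ) → Prop := fun Z Y =>
    Y ∈ Ω ∧ ∃ Y', r Y Y' ∧ ∃ U ∈ Matrix.unitaryGroup (Fin n) ℂ,
      ∀ k ∈ F', matrixNorm2 (Y' k - U * Z k * U.conjTranspose) < ε'
  let c : (I' → Matrix (Fin n) (Fin n) ℂ) → (I → Matrix (Fin n) (Fin n) ℂ) := fun Z =>
    -- The default 0 covers nothing that is needed, but it is a self-adjoint tuple, as centres must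
    -- be.
    if h : ∃ Y, Q Z Y then h.choose else 0
  have hc : ∀ Z Y, Q Z Y → Q Z (c Z) := fun Z Y h => by
    have h' : ∃ Y, Q Z Y := ⟨Y, h⟩
    simp only [c, dif_pos h']
    exact h'.choose_spec
  refine (iInf₂_le (c '' Ω₀) ⟨?_, fun Y hY => ⟨hΩ hY, ?_⟩⟩).trans (Set.encard_image_le c Ω₀)
  · rintro _ ⟨Z, -, rfl⟩
    by_cases h : ∃ Y, Q Z Y
    · exact hΩ (hc Z _ h.choose_spec).1
    · simp only [c, dif_neg h]
      exact fun i => Matrix.isHermitian_zero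
  · obtain ⟨Y', hY', hYY'⟩ := hr Y hY
    obtain ⟨-, Z, hZ, U, hU, hUZ⟩ := hΩ₀.2 hY'
    obtain ⟨-, C', hC', V, hV, hVZ⟩ := hc Z Y ⟨hY, Y', hYY', U, hU, hUZ⟩
    refine ⟨c Z, ⟨Z, hZ, rfl⟩, U * star V, mul_mem hU (Unitary.star_mem hV),
      hlip _ _ _ _ hYY' hC' _ (mul_mem hU (Unitary.star_mem hV)) fun k hk => ?_⟩
    have h1 := hUZ k hk
    have h2 := hVZ k hk
    rw [matrixNorm2_eq_norm2] at h1 h2 ⊢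
    exact norm2_sub_conj_lt (isTracialState_normalizedTrace hn) hU hV h1 h2

end

/-! ### Monotonicity -/

section

open scoped Matrix.Norms.L2Operator

variable {H : Type*} [NormedAddCommGroup H] [InnerProductSpace ℂ H] [CompleteSpace H]
  {M : VonNeumannAlgebra H} (τ : TracialState M)

theorem IsCutoff.sumElim {I J : Type*} {R : I → ℝ} {S : J → ℝ} {x : I → M.toStarSubalgebra}
    {y : J → M.toStarSubalgebra} (hx : IsCutoff R x) (hy : IsCutoff S y) :
    IsCutoff (Sum.elim R S) (Sum.elim x y) := by
  rintro (i | j)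
  exacts [hx i, hy j]

theorem mem_wStarTuple {I : Type*} (x : I → M.toStarSubalgebra) (i : I) :
    (x i : H →L[ℂ] H) ∈ wStarTuple x :=
  (wStar_le_iff _ _).1 le_rfl ⟨i, rfl⟩

/-- If `W*(z') ⊆ W*(z)`, then there are non-commutative polynomials `f m` which map the tuples
bounded by `T` to tuples bounded by `T'` and such that `f m (z)` converges to `z'`. -/
theorem TracialState.exists_seq_approx {K K' : Type*} {z : K → M.toStarSubalgebra}
    {z' : K' → M.toStarSubalgebra} {T : K → ℝ} {T' : K' → ℝ} (hz : IsCutoff T z)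
    (hz' : IsCutoff T' z') (h : wStarTuple z' ≤ wStarTuple z) :
    ∃ f : ℕ → K' → FreeAlgebra ℂ K,
      (∀ p, Tendsto (fun m => norm2 τ.toLin (FreeAlgebra.lift ℂ z (FreeAlgebra.lift ℂ (f m) p)
        - FreeAlgebra.lift ℂ z' p)) atTop (𝓝 0)) ∧
      ∀ m (B : Type*) [CStarAlgebra B] (Y : K → B), (∀ k, IsSelfAdjoint (Y k)) →
        (∀ k, ‖Y k‖ ≤ T k) → ∀ k, IsSelfAdjoint (FreeAlgebra.lift ℂ Y (f m k)) ∧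
          ‖FreeAlgebra.lift ℂ Y (f m k)‖ ≤ T' k := by
  have key := fun (m : ℕ) (k : K') => τ.exists_bounded_approx hz (h (mem_wStarTuple z' k))
    (hz' k).2.1 (hz' k).1 (hz' k).2.2 (Nat.one_div_pos_of_nat (α := ℝ) (n := m))
  choose f hf1 hf2 hf3 using key
  refine ⟨f, fun p => ?_, fun m B _ Y hY hT k => hf3 m k B Y hY hT⟩
  obtain ⟨F, L, -, hL⟩ := exists_norm2_lift_sub_le T' p
  have h1 : Tendsto (fun m : ℕ => L * (1 / ((m : ℝ) + 1))) atTop (𝓝 0) := by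
    simpa using tendsto_one_div_add_atTop_nhds_zero_nat.const_mul L
  refine squeeze_zero (fun m => norm2_nonneg _) (fun m => ?_) h1
  rw [lift_lift]
  exact hL _ τ.toLin τ.isTracialState _ _ (hf1 m) (fun k => (hz' k).2.2) _ (by positivity)
    fun k _ => (hf2 m k).le

theorem TracialState.tendsto_law {K K' : Type*} {z : K → M.toStarSubalgebra}
    {z' : K' → M.toStarSubalgebra} {f : ℕ → K' → FreeAlgebra ℂ K}
    (hf : ∀ p, Tendsto (fun m => norm2 τ.toLin (FreeAlgebra.lift ℂ z (FreeAlgebra.lift ℂ (f m) p)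
        - FreeAlgebra.lift ℂ z' p)) atTop (𝓝 0)) :
    Tendsto (fun m p => τ.law z (FreeAlgebra.lift ℂ (f m) p)) atTop (𝓝 (τ.law z')) := by
  refine tendsto_pi_nhds.2 fun p => ?_
  rw [tendsto_iff_norm_sub_tendsto_zero]
  refine squeeze_zero (fun m => norm_nonneg _) (fun m => ?_) (hf p)
  rw [TracialState.law, TracialState.law, ← map_sub]
  exact τ.isTracialState.norm_map_le_norm2 _

/-- Monotonicity of the orbital covering numbers of microstate spaces under a non-commutative
polynomial change of variables. -/
theorem orbCoveringNumber_microstates_le {I J I' J' : Type*} {R : I → ℝ} {S : J → ℝ} {R' : I' → ℝ}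
    {S' : J' → ℝ} {F : Finset I} {F' : Finset I'} {ε ε' L : ℝ} {q : I → FreeAlgebra ℂ I'}
    (hq : ∀ i ∈ F, ∀ (A : Type) [CStarAlgebra A] (τ : A →ₗ[ℂ] ℂ)
      (_ : IsTracialState τ) (Y Z : I' → A), (∀ k, ‖Y k‖ ≤ R' k) → (∀ k, ‖Z k‖ ≤ R' k) →
      ∀ δ, 0 ≤ δ → (∀ k ∈ F', norm2 τ (Y k - Z k) ≤ δ) →
      norm2 τ (FreeAlgebra.lift ℂ Y (q i) - FreeAlgebra.lift ℂ Z (q i)) ≤ L * δ)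
    (hε : 0 < ε) (hε' : 0 < ε') (hL : L * (2 * ε') ≤ ε / 2)
    {f : I' ⊕ J' → FreeAlgebra ℂ (I ⊕ J)}
    (hf : ∀ (B : Type) [CStarAlgebra B] (Y : I ⊕ J → B), (∀ k, IsSelfAdjoint (Y k)) →
        (∀ k, ‖Y k‖ ≤ Sum.elim R S k) → ∀ k, IsSelfAdjoint (FreeAlgebra.lift ℂ Y (f k)) ∧
          ‖FreeAlgebra.lift ℂ Y (f k)‖ ≤ Sum.elim R' S' k)
    {O : Set (FreeAlgebra ℂ (I ⊕ J) → ℂ)} {O' : Set (FreeAlgebra ℂ (I' ⊕ J') → ℂ)}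
    (hO : ∀ l ∈ O, (fun p => l (FreeAlgebra.lift ℂ f p)) ∈ lawSpace (Sum.elim R' S') →
      (fun p => l (FreeAlgebra.lift ℂ f p)) ∈ O')
    {g : I → FreeAlgebra ℂ (I ⊕ J)}
    (hg : ∀ i, g i = FreeAlgebra.lift ℂ (fun k => f (Sum.inl k)) (q i) - FreeAlgebra.ι ℂ (Sum.inl i))
    (hO2 : ∀ l ∈ O, ∀ i ∈ F, (l (ncStar (g i) * g i)).re < (ε / 4) ^ 2)
    {n : ℕ} (hn : n ≠ 0) :
    orbCoveringNumber F ε ((fun Y i => Y (Sum.inl i)) '' microstates (Sum.elim R S) O n) ≤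
      orbCoveringNumber F' ε'
        ((fun Y i => Y (Sum.inl i)) '' microstates (Sum.elim R' S') O' n) := by
  have hτ := isTracialState_normalizedTrace hn
  refine orbCoveringNumber_le hn ?_
    (fun Y Y' => ∃ W ∈ microstates (Sum.elim R S) O n, Y = (fun i => W (Sum.inl i)) ∧
      Y' = fun k => FreeAlgebra.lift ℂ W (f (Sum.inl k))) ?_ ?_
  · rintro _ ⟨W, hW, rfl⟩ i
    exact hW.1 _
  · rintro _ ⟨W, hW, rfl⟩
    refine ⟨_, ⟨fun k => FreeAlgebra.lift ℂ W (f k), ?_, rfl⟩, W, hW, rfl, rfl⟩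
    have h1 := hf _ W hW.1 hW.2.1
    refine ⟨fun k => (h1 k).1, fun k => (h1 k).2, ?_⟩
    have e : matrixLaw (fun k => FreeAlgebra.lift ℂ W (f k)) =
        fun p => matrixLaw W (FreeAlgebra.lift ℂ f p) := by
      funext p; rw [matrixLaw_eq, matrixLaw_eq, lift_lift]
    have h2 := matrixLaw_mem_lawSpace hn (fun k => (h1 k).1) (fun k => (h1 k).2)
    rw [e] at h2 ⊢
    exact hO _ hW.2.2 h2
  · rintro _ _ _ _ ⟨W, hW, rfl, rfl⟩ ⟨X, hX, rfl, rfl⟩ V hV hVk i hi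
    -- `hO2` states, in terms of the law alone, that `q` composed with `f` almost returns `W i` in
    -- 2-norm.
    have near : ∀ W ∈ microstates (Sum.elim R S) O n, norm2 (normalizedTrace n)
        (FreeAlgebra.lift ℂ (fun k => FreeAlgebra.lift ℂ W (f (Sum.inl k))) (q i) - W (Sum.inl i))
        < ε / 4 := by
      intro W hW
      have h1 := hO2 _ hW.2.2 i hi
      rw [matrixLaw_eq, map_mul, lift_ncStar hW.1, ← hτ.sq_norm2, hg, map_sub, lift_lift,
        FreeAlgebra.lift_ι_apply] at h1
      exact lt_of_pow_lt_pow_left₀ 2 (by positivity) h1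
    have hb : ∀ W ∈ microstates (Sum.elim R S) O n, ∀ k,
        ‖FreeAlgebra.lift ℂ W (f (Sum.inl k))‖ ≤ R' k :=
      fun W hW k => (hf _ W hW.1 hW.2.1 (Sum.inl k)).2
    have hV1 : ‖V‖ = 1 := by
      have : NeZero n := ⟨hn⟩
      exact CStarRing.norm_of_mem_unitary hV
    -- The triangle inequality runs from `W i` through `q i (f W)` and `V q i (f X) V*` to `V X i
    -- V*`, with costs below `ε / 4`, at most `ε / 2`, and below `ε / 4`. The Lipschitz bound gives
    -- the middle term, since `q i` commutes with conjugation by `V`.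
    have h1 := hq i hi _ _ hτ (fun k => FreeAlgebra.lift ℂ W (f (Sum.inl k)))
      (fun k => V * FreeAlgebra.lift ℂ X (f (Sum.inl k)) * star V) (hb W hW)
      (fun k => by
        refine (norm_mul_le _ _).trans ?_
        rw [norm_star, hV1, mul_one]
        refine (norm_mul_le _ _).trans ?_
        rw [hV1, one_mul]
        exact hb X hX k) (2 * ε') (by positivity)
      (fun k hk => by rw [← matrixNorm2_eq_norm2]; exact (hVk k hk).le)
    rw [lift_unitary_conj hV] at h1
    have h2 := near W hW
    have h3 := near X hX
    rw [← norm2_unitary_conj hτ hV, mul_sub, sub_mul] at h3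
    rw [norm2_sub_comm] at h2
    rw [matrixNorm2_eq_norm2]
    have h4 := hτ.norm2_sub_le (W (Sum.inl i))
      (FreeAlgebra.lift ℂ (fun k => FreeAlgebra.lift ℂ W (f (Sum.inl k))) (q i))
      (V * X (Sum.inl i) * star V)
    have h5 := hτ.norm2_sub_le
      (FreeAlgebra.lift ℂ (fun k => FreeAlgebra.lift ℂ W (f (Sum.inl k))) (q i))
      (V * FreeAlgebra.lift ℂ (fun k => FreeAlgebra.lift ℂ X (f (Sum.inl k))) (q i) * star V)
      (V * X (Sum.inl i) * star V)
    change norm2 (normalizedTrace n) (W (Sum.inl i) - V * X (Sum.inl i) * star V) < ε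
    linarith

end

/-! ### From covering numbers to entropies -/

section

variable {H : Type*} [NormedAddCommGroup H] [InnerProductSpace ℂ H] [CompleteSpace H]
  {M : VonNeumannAlgebra H} (τ : TracialState M)

theorem continuous_comp_lift {K K' : Type*} (f : K' → FreeAlgebra ℂ K) :
    Continuous fun (l : FreeAlgebra ℂ K → ℂ) (p : FreeAlgebra ℂ K') => l (FreeAlgebra.lift ℂ f p) :=
  continuous_pi fun _ => continuous_apply _

/-- The order of choices is forced by the quantifiers: `q`, and with it the finite set and radius on
the `x'` side, depend on `F` and `ε` only; `f m` and the neighborhood `O` may then depend on `O'`.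
The polynomials `q i` need no norm control, whereas `f m` must preserve the cutoffs. -/
theorem entropyTuple_le {I J I' J' : Type*} {R : I → ℝ} {S : J → ℝ} {R' : I' → ℝ} {S' : J' → ℝ}
    {x : I → M.toStarSubalgebra} {y : J → M.toStarSubalgebra}
    {x' : I' → M.toStarSubalgebra} {y' : J' → M.toStarSubalgebra}
    (hx : IsCutoff R x) (hy : IsCutoff S y) (hx' : IsCutoff R' x') (hy' : IsCutoff S' y')
    (h₁ : wStarTuple (Sum.elim x' y') ≤ wStarTuple (Sum.elim x y))
    (h₂ : wStarTuple x ≤ wStarTuple x') :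
    entropyTuple τ R S x y ≤ entropyTuple τ R' S' x' y' := by
  classical
  have hτ := τ.isTracialState
  have hz := hx.sumElim hy
  refine iSup_le fun F => iSup_le fun ε => iSup_le fun hε => ?_
  have key := fun i => τ.exists_norm2_lift_sub_lt (fun k => (hx' k).2.1) (h₂ (mem_wStarTuple x i))
    (show 0 < ε / 4 by positivity)
  choose q hq using key
  have key' := fun i => exists_norm2_lift_sub_le R' (q i)
  choose G L hL0 hL using key'
  set L₀ := ∑ i ∈ F, L i with hL₀
  have hL₀0 : 0 ≤ L₀ := Finset.sum_nonneg fun i _ => hL0 i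
  set ε' := ε / (4 * (L₀ + 1)) with hε'
  have hε'0 : 0 < ε' := by positivity
  have hLε : L₀ * (2 * ε') ≤ ε / 2 := by
    rw [hε', mul_div_assoc', mul_div_assoc', div_le_iff₀ (by positivity)]
    nlinarith
  refine le_trans ?_ (le_iSup_of_le (F.biUnion G) (le_iSup_of_le ε' (le_iSup_of_le hε'0 le_rfl)))
  refine le_iInf₂ fun O' hO' => ?_
  -- `U` is open among all functions, and only its trace on the law space lies in `O'`; this
  -- suffices because laws of bounded matrix tuples belong to that space.
  obtain ⟨U, hU, hlU, hUO⟩ := mem_nhdsWithin.1 hO'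
  obtain ⟨f, hf, hfb⟩ := τ.exists_seq_approx hz (hx'.sumElim hy') h₁
  have hlaw := (τ.tendsto_law hf).eventually (hU.mem_nhds hlU)
  have hnear : ∀ i ∈ F, ∀ᶠ m in atTop, norm2 τ.toLin (FreeAlgebra.lift ℂ
      (fun k => FreeAlgebra.lift ℂ (Sum.elim x y) (f m (Sum.inl k))) (q i) - x i) < ε / 4 := by
    intro i _
    -- Evaluating the limit at `q i`, read as a polynomial in the `I'`-variables, leaves only `‖q i
    -- (x') - x i‖₂`, which is below `ε / 4`.
    have h1 := (hf (FreeAlgebra.lift ℂ (fun k => FreeAlgebra.ι ℂ (Sum.inl k)) (q i))).add_const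
      (norm2 τ.toLin (FreeAlgebra.lift ℂ x' (q i) - x i))
    rw [zero_add] at h1
    filter_upwards [h1.eventually (gt_mem_nhds (hq i))] with m hm
    simp only [lift_lift, FreeAlgebra.lift_ι_apply, Sum.elim_inl] at hm
    exact (hτ.norm2_sub_le _ _ _).trans_lt hm
  obtain ⟨m, hm1, hm2⟩ := (hlaw.and ((eventually_all_finset F).2 hnear)).exists
  let g : I → FreeAlgebra ℂ (I ⊕ J) := fun i =>
    FreeAlgebra.lift ℂ (fun k => f m (Sum.inl k)) (q i) - FreeAlgebra.ι ℂ (Sum.inl i)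
  let O : Set (FreeAlgebra ℂ (I ⊕ J) → ℂ) :=
    {l | (fun p => l (FreeAlgebra.lift ℂ (f m) p)) ∈ U} ∩
      ⋂ i ∈ F, {l | (l (ncStar (g i) * g i)).re < (ε / 4) ^ 2}
  have hO : IsOpen O := by
    refine (hU.preimage (continuous_comp_lift (f m))).inter
      (isOpen_biInter_finset fun i _ => ?_)
    exact isOpen_lt (Complex.continuous_re.comp (continuous_apply _)) continuous_const
  have hlO : τ.law (Sum.elim x y) ∈ O := by
    refine ⟨hm1, Set.mem_iInter₂.2 fun i hi => ?_⟩
    change (τ.toLin _).re < _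
    rw [map_mul, lift_ncStar (fun k => (hz k).2.1), ← hτ.sq_norm2]
    have h1 := hm2 i hi
    refine pow_lt_pow_left₀ ?_ (norm2_nonneg _) two_ne_zero
    simpa only [g, map_sub, lift_lift, FreeAlgebra.lift_ι_apply, Sum.elim_inl] using h1
  refine iInf₂_le_of_le O (mem_nhdsWithin_of_mem_nhds (hO.mem_nhds hlO)) ?_
  refine limsup_le_limsup ?_
  -- For `n = 0` the normalized trace is not a state; the limsup ignores this value.
  filter_upwards [eventually_ne_atTop 0] with n hn
  refine mul_le_mul_of_nonneg_left (ENNReal.log_monotone (ENat.toENNReal_mono ?_))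
    (EReal.coe_nonneg.2 (by positivity))
  refine orbCoveringNumber_microstates_le (q := q) (L := L₀) (f := f m) (g := g) ?_ hε hε'0 hLε
    (hfb m) (fun l hl h => hUO ⟨hl.1, h⟩) (fun i => rfl) (fun l hl i hi => ?_) hn
  · intro i hi A _ σ hσ Y Z hY hZ δ hδ h
    refine (hL i A σ hσ Y Z hY hZ δ hδ fun k hk => h k (Finset.mem_biUnion.2 ⟨i, hi, hk⟩)).trans ?_
    exact mul_le_mul_of_nonneg_right (Finset.single_le_sum (fun i _ => hL0 i) hi) hδ
  · exact Set.mem_iInter₂.1 hl.2 i hi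

theorem entropyTuple_eq {I J I' J' : Type*} {R : I → ℝ} {S : J → ℝ} {R' : I' → ℝ} {S' : J' → ℝ}
    {x : I → M.toStarSubalgebra} {y : J → M.toStarSubalgebra}
    {x' : I' → M.toStarSubalgebra} {y' : J' → M.toStarSubalgebra}
    (hx : IsCutoff R x) (hy : IsCutoff S y) (hx' : IsCutoff R' x') (hy' : IsCutoff S' y')
    (h₁ : wStarTuple (Sum.elim x y) = wStarTuple (Sum.elim x' y'))
    (h₂ : wStarTuple x = wStarTuple x') :
    entropyTuple τ R S x y = entropyTuple τ R' S' x' y' :=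
  le_antisymm (entropyTuple_le τ hx hy hx' hy' h₁.ge h₂.le)
    (entropyTuple_le τ hx' hy' hx hy h₁.le h₂.ge)

/-! ### Restriction to a von Neumann subalgebra -/

theorem vnIncl_lift {N : VonNeumannAlgebra H} (h : N ≤ M) {K : Type*} (z : K → N.toStarSubalgebra)
    (p : FreeAlgebra ℂ K) :
    vnIncl h (FreeAlgebra.lift ℂ z p) = FreeAlgebra.lift ℂ (fun k => vnIncl h (z k)) p := by
  apply Subtype.ext
  rw [coe_lift]
  exact coe_lift z p

/-- The ambient algebra enters only through the law of the tuple, and the inclusion preserves it. -/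
theorem entropyTuple_restrict {N : VonNeumannAlgebra H} (h : N ≤ M) {I J : Type*} (R : I → ℝ)
    (S : J → ℝ) (x : I → N.toStarSubalgebra) (y : J → N.toStarSubalgebra) :
    entropyTuple (τ.restrict h) R S x y =
      entropyTuple τ R S (fun i => vnIncl h (x i)) (fun j => vnIncl h (y j)) := by
  have e : (τ.restrict h).law (Sum.elim x y) =
      τ.law (Sum.elim (fun i => vnIncl h (x i)) (fun j => vnIncl h (y j))) := by
    funext p
    have e' : (Sum.elim (fun i => vnIncl h (x i)) (fun j => vnIncl h (y j))) =
        fun k => vnIncl h (Sum.elim x y k) := by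
      funext k; cases k <;> rfl
    rw [e', TracialState.law, TracialState.law, ← vnIncl_lift]
    rfl
  rw [entropyTuple, entropyTuple, e]

theorem IsCutoff.vnIncl {N : VonNeumannAlgebra H} (h : N ≤ M) {I : Type*} {R : I → ℝ}
    {x : I → N.toStarSubalgebra} (hx : IsCutoff R x) : IsCutoff R (fun i => vnIncl h (x i)) :=
  fun i => ⟨(hx i).1, by
    have h1 : star (x i : H →L[ℂ] H) = x i := congrArg Subtype.val (hx i).2.1
    exact Subtype.ext h1, (hx i).2.2⟩

theorem isCutoff_allSelfAdjoint (N M : VonNeumannAlgebra H) :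
    IsCutoff (fun a => ‖(allSelfAdjoint N M a : H →L[ℂ] H)‖ + 1) (allSelfAdjoint N M) :=
  fun a => ⟨by positivity, a.2.1, by linarith⟩

theorem wStarTuple_sumElim {I J : Type*} (x : I → M.toStarSubalgebra)
    (y : J → M.toStarSubalgebra) (h : wStarTuple x ≤ wStarTuple y) :
    wStarTuple (Sum.elim x y) = wStarTuple y := by
  apply le_antisymm
  · rw [wStarTuple, wStar_le_iff]
    rintro _ ⟨i | j, rfl⟩
    exacts [h (mem_wStarTuple x i), mem_wStarTuple y j]
  · rw [wStarTuple, wStar_le_iff]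
    rintro _ ⟨j, rfl⟩
    exact mem_wStarTuple (Sum.elim x y) (Sum.inr j)

theorem wStarTuple_sumElim_allSelfAdjoint {N : VonNeumannAlgebra H} (h : N ≤ M) :
    wStarTuple (Sum.elim (allSelfAdjoint N M) (allSelfAdjoint M M)) = M := by
  rw [wStarTuple_sumElim, wStarTuple_allSelfAdjoint M M le_rfl]
  rw [wStarTuple_allSelfAdjoint M N h, wStarTuple_allSelfAdjoint M M le_rfl]
  exact h

theorem wStarTuple_sumElim_vnIncl {N : VonNeumannAlgebra H} (h : N ≤ M) {I J : Type*}
    (x : I → N.toStarSubalgebra) (y : J → N.toStarSubalgebra) :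
    wStarTuple (Sum.elim (fun i => vnIncl h (x i)) (fun j => vnIncl h (y j))) =
      wStarTuple (Sum.elim x y) := by
  rw [wStarTuple, wStarTuple]
  congr 2
  funext k
  cases k <;> rfl

theorem entropyInPresence_restrict_eq {N P : VonNeumannAlgebra H} (hNP : N ≤ P) (hPM : P ≤ M)
    {I J : Type*} {R : I → ℝ} {S : J → ℝ} {x : I → M.toStarSubalgebra}
    {y : J → M.toStarSubalgebra} (hx : IsCutoff R x) (hy : IsCutoff S y)
    (h₁ : wStarTuple x = N) (h₂ : wStarTuple (Sum.elim x y) = P) :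
    entropyInPresence (τ.restrict hPM) N = entropyTuple τ R S x y := by
  rw [entropyInPresence, entropyTuple_restrict]
  refine entropyTuple_eq τ ((isCutoff_allSelfAdjoint N P).vnIncl hPM)
    ((isCutoff_allSelfAdjoint P P).vnIncl hPM) hx hy ?_ ?_
  · rw [wStarTuple_sumElim_vnIncl, wStarTuple_sumElim_allSelfAdjoint hNP, h₂]
  · rw [h₁]
    exact wStarTuple_allSelfAdjoint P N hNP

theorem entropyInPresence_mono {P N : VonNeumannAlgebra H} (hPN : P ≤ N) (hNM : N ≤ M) :
    entropyInPresence τ P ≤ entropyInPresence τ N := by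
  refine entropyTuple_le τ (isCutoff_allSelfAdjoint P M) (isCutoff_allSelfAdjoint M M)
    (isCutoff_allSelfAdjoint N M) (isCutoff_allSelfAdjoint M M) ?_ ?_
  · rw [wStarTuple_sumElim_allSelfAdjoint hNM,
      wStarTuple_sumElim_allSelfAdjoint (hPN.trans hNM)]
  · rw [wStarTuple_allSelfAdjoint M P (hPN.trans hNM), wStarTuple_allSelfAdjoint M N hNM]
    exact hPN

/-- After transport into `M`, both sides concern generators of `P`; the left side is in the presence
of the larger algebra, so `entropyTuple_le` applies. -/
theorem entropyInPresence_le_restrict {P N : VonNeumannAlgebra H} (hPN : P ≤ N) (hNM : N ≤ M) :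
    entropyInPresence τ P ≤ entropyInPresence (τ.restrict hNM) P := by
  rw [entropyInPresence, entropyInPresence, entropyTuple_restrict]
  refine entropyTuple_le τ (isCutoff_allSelfAdjoint P M) (isCutoff_allSelfAdjoint M M)
    ((isCutoff_allSelfAdjoint P N).vnIncl hNM) ((isCutoff_allSelfAdjoint N N).vnIncl hNM) ?_ ?_
  · rw [wStarTuple_sumElim_vnIncl, wStarTuple_sumElim_allSelfAdjoint hPN,
      wStarTuple_sumElim_allSelfAdjoint (hPN.trans hNM)]
    exact hNM
  · rw [wStarTuple_allSelfAdjoint M P (hPN.trans hNM)]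
    exact (wStarTuple_allSelfAdjoint N P hPN).ge

end

theorem mainTheorem11 {H : Type*} [NormedAddCommGroup H] [InnerProductSpace ℂ H] [CompleteSpace H]
    (M : VonNeumannAlgebra H) (τ : TracialState M) :
    -- monotonicity of `h_{R,S}(x : y)`
    (∀ (I J I' J' : Type*) (R : I → ℝ) (S : J → ℝ) (R' : I' → ℝ) (S' : J' → ℝ)
      (x : I → M.toStarSubalgebra) (y : J → M.toStarSubalgebra)
      (x' : I' → M.toStarSubalgebra) (y' : J' → M.toStarSubalgebra),
      IsCutoff R x → IsCutoff S y → IsCutoff R' x' → IsCutoff S' y' →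
      wStarTuple (Sum.elim x' y') ≤ wStarTuple (Sum.elim x y) →
      wStarTuple x ≤ wStarTuple x' →
      entropyTuple τ R S x y ≤ entropyTuple τ R' S' x' y') ∧
    -- independence of the cutoff constants
    (∀ (I J : Type*) (R R₁ : I → ℝ) (S S₁ : J → ℝ)
      (x : I → M.toStarSubalgebra) (y : J → M.toStarSubalgebra),
      IsCutoff R x → IsCutoff S y → IsCutoff R₁ x → IsCutoff S₁ y →
      entropyTuple τ R S x y = entropyTuple τ R₁ S₁ x y) ∧
    -- independence of the generators
    (∀ (I J I' J' : Type*) (R : I → ℝ) (S : J → ℝ) (R' : I' → ℝ) (S' : J' → ℝ)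
      (x : I → M.toStarSubalgebra) (y : J → M.toStarSubalgebra)
      (x' : I' → M.toStarSubalgebra) (y' : J' → M.toStarSubalgebra),
      IsCutoff R x → IsCutoff S y → IsCutoff R' x' → IsCutoff S' y' →
      wStarTuple (Sum.elim x y) = wStarTuple (Sum.elim x' y') →
      wStarTuple x = wStarTuple x' →
      entropyTuple τ R S x y = entropyTuple τ R' S' x' y') ∧
    -- `h(N : P)` may be computed from any tuples generating `N` and `P`
    (∀ (N P : VonNeumannAlgebra H) (_ : N ≤ P) (hPM : P ≤ M) (I J : Type*) (R : I → ℝ) (S : J → ℝ)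
      (x : I → M.toStarSubalgebra) (y : J → M.toStarSubalgebra),
      IsCutoff R x → IsCutoff S y → wStarTuple x = N → wStarTuple (Sum.elim x y) = P →
      entropyInPresence (τ.restrict hPM) N = entropyTuple τ R S x y) ∧
    -- monotonicity in the first variable
    (∀ P N : VonNeumannAlgebra H, P ≤ N → N ≤ M →
      entropyInPresence τ P ≤ entropyInPresence τ N) ∧
    -- monotonicity in the second variable
    (∀ (P N : VonNeumannAlgebra H) (_ : P ≤ N) (hNM : N ≤ M),
      entropyInPresence τ P ≤ entropyInPresence (τ.restrict hNM) P) := by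
  refine ⟨fun I J I' J' R S R' S' x y x' y' hx hy hx' hy' h₁ h₂ =>
      entropyTuple_le τ hx hy hx' hy' h₁ h₂,
    fun I J R R₁ S S₁ x y hx hy hx₁ hy₁ => entropyTuple_eq τ hx hy hx₁ hy₁ rfl rfl,
    fun I J I' J' R S R' S' x y x' y' hx hy hx' hy' h₁ h₂ =>
      entropyTuple_eq τ hx hy hx' hy' h₁ h₂,
    fun N P hNP hPM I J R S x y hx hy h₁ h₂ =>
      entropyInPresence_restrict_eq τ hNP hPM hx hy h₁ h₂,
    fun P N hPN hNM => entropyInPresence_mono τ hPN hNM,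
    fun P N hPN hNM => entropyInPresence_le_restrict τ hPN hNM⟩
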